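/- Let $\mathbb{K}$ be a field of characteristic zero and let $\mathbf{Ch}(\mathbb{K})$ be the symmetric monoidal category of (possibly unbounded) chain complexes of $\mathbb{K}$-vector spaces, with symmetric braiding given by the Koszul sign rule. Let $\mathbf{Alg}_{\mathsf{uLie}}$ be the category of unital Lie algebras in $\mathbf{Ch}(\mathbb{K})$, i.e. chain complexes $V$ with chain maps $[\cdot,\cdot]:V\otimes V\to V$ and $\eta:\mathbb{K}\to V$ such that $[\cdot,\cdot]$ satisfies the graded antisymmetry and Jacobi identities and $[v,\eta(1)]=0$ for all $v\in V$. Let $\mathbf{Alg}_{\mathsf{As}}$ be the category of associative and unital algebras in $\mathbf{Ch}(\mathbb{K})$, i.e. differential graded algebras. Let $\overline{\mathbf{C}}=(\mathbf{C},\perp)$ be an orthogonal category: a small category $\mathbf{C}$ with a relation $\perp$ on pairs of morphisms with common target that is symmetric and such that $f_1\perp f_2$ implies $g f_1 h_1\perp g f_2 h_2$ for all composable $g,h_1,h_2$. Let $\mathbf{LFT}(\overline{\mathbf{C}})$ (linear field theories) be the full subcategory of the category of functors $\mathfrak{B}:\mathbf{C}\to\mathbf{Alg}_{\mathsf{uLie}}$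 on those $\mathfrak{B}$ for which the map $[\mathfrak{B}(f_1)(-),\mathfrak{B}(f_2)(-)]:\mathfrak{B}(c_1)\otimes\mathfrak{B}(c_2)\to\mathfrak{B}(c)$ is zero for all $(f_1:c_1\to c)\perp(f_2:c_2\to c)$. Let $\mathbf{QFT}(\overline{\mathbf{C}})$ (quantum field theories) be the full subcategory of the category of functors $\mathfrak{A}:\mathbf{C}\to\mathbf{Alg}_{\mathsf{As}}$ defined by the same condition with the graded commutator in place of the Lie bracket. The linear quantization functor $\mathfrak{Q}_{\mathsf{lin}}:\mathbf{LFT}(\overline{\mathbf{C}})\to\mathbf{QFT}(\overline{\mathbf{C}})$ is the left adjoint of the functor $\mathfrak{U}_{\mathsf{lin}}:\mathbf{QFT}(\overline{\mathbf{C}})\to\mathbf{LFT}(\overline{\mathbf{C}})$ that replaces objectwise the product of an algebra by its graded commutator and keeps the unit. Explicitly, $\mathfrak{Q}_{\mathsf{lin}}(\mathfrak{B})(c)=\phi_!(\mathfrak{B}(c))$, where $\phi_!(V)$ is the unital universal enveloping algebra of $V$, i.e. the quotient of the tensor algebra $T^\otimes V$ by the two-sided differential graded ideal generated by $v_1\otimes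 v_2-(-1)^{|v_1||v_2|}v_2\otimes v_1-[v_1,v_2]$, for homogeneous $v_1,v_2\in V$, and $\eta(1)-1$. Let $W\subseteq\mathrm{Mor}\,\mathbf{C}$ be a subset. A linear or quantum field theory $\mathfrak{A}$ on $\overline{\mathbf{C}}$ is called homotopy $W$-constant if for every $(f:c\to c')\in W$ the chain map underlying $\mathfrak{A}(f):\mathfrak{A}(c)\to\mathfrak{A}(c')$ is a quasi-isomorphism. Then for every homotopy $W$-constant $\mathfrak{B}\in\mathbf{LFT}(\overline{\mathbf{C}})$, the quantum field theory $\mathfrak{Q}_{\mathsf{lin}}(\mathfrak{B})\in\mathbf{QFT}(\overline{\mathbf{C}})$ is homotopy $W$-constant. -/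

import Mathlib

open CategoryTheory

universe u v w

noncomputable section

namespace LinearQuantization

/-- The category `Ch(K)` of unbounded chain complexes of `K`-vector spaces (the differential lowers
the degree by one). -/
abbrev Ch (K : Type u) [Field K] := ChainComplex (ModuleCat.{u} K) ℤ

/-- A unital Lie algebra in the symmetric monoidal category `Ch(K)`, i.e. an algebra over the unital
Lie operad. A chain map out of a tensor product `V ⊗ V` is given by its bilinear components
`V_p × V_q → V_{p+q}` and is compatible with the differentials by the graded Leibniz rule; a chain
map out of the monoidal unit is a cycle of degree zero. Permuting inputs produces Koszul signs. -/
structure ULie (K : Type u) [Field K] where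
  /-- the underlying chain complex -/
  cpx : Ch K
  /-- the Lie bracket -/
  bracket : ∀ {p q n : ℤ}, p + q = n → (cpx.X p →ₗ[K] cpx.X q →ₗ[K] cpx.X n)
  /-- the unit -/
  unit : cpx.X 0
  d_bracket : ∀ {p q n p' q' n' : ℤ} (h : p + q = n) (h₁ : p' + q = n') (h₂ : p + q' = n')
    (_ : p' + 1 = p) (_ : q' + 1 = q) (x : cpx.X p) (y : cpx.X q),
    cpx.d n n' (bracket h x y) =
      bracket h₁ (cpx.d p p' x) y + p.negOnePow • bracket h₂ x (cpx.d q q' y)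
  d_unit : cpx.d 0 (-1) unit = 0
  bracket_antisymm : ∀ {p q n : ℤ} (h : p + q = n) (h' : q + p = n) (x : cpx.X p) (y : cpx.X q),
    bracket h x y = -((p * q).negOnePow • bracket h' y x)
  jacobi : ∀ {p q r pq qr rp n : ℤ} (hpq : p + q = pq) (hqr : q + r = qr) (hrp : r + p = rp)
    (h₁ : p + qr = n) (h₂ : q + rp = n) (h₃ : r + pq = n)
    (x : cpx.X p) (y : cpx.X q) (z : cpx.X r),
    bracket h₁ x (bracket hqr y z) +
      (p * (q + r)).negOnePow • bracket h₂ y (bracket hrp z x) +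
      (r * (p + q)).negOnePow • bracket h₃ z (bracket hpq x y) = 0
  bracket_unit : ∀ {p n : ℤ} (h : p + 0 = n) (x : cpx.X p), bracket h x unit = 0

/-- A morphism of unital Lie algebras in `Ch(K)`. -/
@[ext]
structure ULie.Hom {K : Type u} [Field K] (V W : ULie K) where
  /-- the underlying chain map -/
  hom : V.cpx ⟶ W.cpx
  map_bracket : ∀ {p q n : ℤ} (h : p + q = n) (x : V.cpx.X p) (y : V.cpx.X q),
    hom.f n (V.bracket h x y) = W.bracket h (hom.f p x) (hom.f q y)
  map_unit : hom.f 0 V.unit = W.unit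

instance ULie.category {K : Type u} [Field K] : Category (ULie K) where
  Hom V W := ULie.Hom V W
  id V := { hom := 𝟙 V.cpx, map_bracket := by intros; simp, map_unit := by simp }
  comp f g :=
    { hom := f.hom ≫ g.hom
      map_bracket := by intros; simp [f.map_bracket, g.map_bracket]
      map_unit := by simp [f.map_unit, g.map_unit] }

/-- The chain complex underlying a unital Lie algebra. -/
def ULie.forget (K : Type u) [Field K] : ULie K ⥤ Ch K where
  obj V := V.cpx
  map f := f.hom

/-- An associative and unital algebra in the symmetric monoidal category `Ch(K)`, i.e. a
differential graded algebra. -/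
structure DGA (K : Type u) [Field K] where
  /-- the underlying chain complex -/
  cpx : Ch K
  /-- the multiplication -/
  mul : ∀ {p q n : ℤ}, p + q = n → (cpx.X p →ₗ[K] cpx.X q →ₗ[K] cpx.X n)
  /-- the unit -/
  one : cpx.X 0
  d_mul : ∀ {p q n p' q' n' : ℤ} (h : p + q = n) (h₁ : p' + q = n') (h₂ : p + q' = n')
    (_ : p' + 1 = p) (_ : q' + 1 = q) (x : cpx.X p) (y : cpx.X q),
    cpx.d n n' (mul h x y) =
      mul h₁ (cpx.d p p' x) y + p.negOnePow • mul h₂ x (cpx.d q q' y)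
  d_one : cpx.d 0 (-1) one = 0
  one_mul : ∀ {p : ℤ} (h : 0 + p = p) (x : cpx.X p), mul h one x = x
  mul_one : ∀ {p : ℤ} (h : p + 0 = p) (x : cpx.X p), mul h x one = x
  mul_assoc : ∀ {p q r pq qr n : ℤ} (hpq : p + q = pq) (hqr : q + r = qr)
    (h₁ : pq + r = n) (h₂ : p + qr = n) (x : cpx.X p) (y : cpx.X q) (z : cpx.X r),
    mul h₁ (mul hpq x y) z = mul h₂ x (mul hqr y z)

/-- A morphism of differential graded algebras. -/
@[ext]
structure DGA.Hom {K : Type u} [Field K] (A B : DGA K) where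
  /-- the underlying chain map -/
  hom : A.cpx ⟶ B.cpx
  map_mul : ∀ {p q n : ℤ} (h : p + q = n) (x : A.cpx.X p) (y : A.cpx.X q),
    hom.f n (A.mul h x y) = B.mul h (hom.f p x) (hom.f q y)
  map_one : hom.f 0 A.one = B.one

instance DGA.category {K : Type u} [Field K] : Category (DGA K) where
  Hom A B := DGA.Hom A B
  id A := { hom := 𝟙 A.cpx, map_mul := by intros; simp, map_one := by simp }
  comp f g :=
    { hom := f.hom ≫ g.hom
      map_mul := by intros; simp [f.map_mul, g.map_mul]
      map_one := by simp [f.map_one, g.map_one] }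

/-- The chain complex underlying a differential graded algebra. -/
def DGA.forget (K : Type u) [Field K] : DGA K ⥤ Ch K where
  obj A := A.cpx
  map f := f.hom

/-- The graded commutator `μ - μᵒᵖ` of a differential graded algebra,
`(x, y) ↦ x y - (-1)^{pq} y x` on elements of degrees `p` and `q`. -/
def DGA.commutator {K : Type u} [Field K] (A : DGA K) {p q n : ℤ} (h : p + q = n) :
    A.cpx.X p →ₗ[K] A.cpx.X q →ₗ[K] A.cpx.X n :=
  A.mul h - (p * q).negOnePow • (A.mul (by omega : q + p = n)).flip

lemma DGA.commutator_apply {K : Type u} [Field K] (A : DGA K) {p q n : ℤ} (h : p + q = n)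
    (h' : q + p = n) (x : A.cpx.X p) (y : A.cpx.X q) :
    A.commutator h x y = A.mul h x y - (p * q).negOnePow • A.mul h' y x := rfl

lemma map_sign_smul {M N F : Type*} [AddCommGroup M] [AddCommGroup N] [FunLike F M N]
    [AddMonoidHomClass F M N] (f : F) (e : ℤˣ) (x : M) : f (e • x) = e • f x := by
  obtain rfl | rfl := Int.units_eq_one_or e <;> simp

lemma sign_smul_apply {R M N : Type*} [CommRing R] [AddCommGroup M] [AddCommGroup N] [Module R M]
    [Module R N] (e : ℤˣ) (f : M →ₗ[R] N) (x : M) : (e • f) x = e • f x := by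
  obtain rfl | rfl := Int.units_eq_one_or e <;> simp

lemma DGA.commutator_leibniz {K : Type u} [Field K] (A : DGA K) {p q n p' q' n' : ℤ}
    (h : p + q = n) (h₁ : p' + q = n') (h₂ : p + q' = n') (hp : p' + 1 = p) (hq : q' + 1 = q)
    (x : A.cpx.X p) (y : A.cpx.X q) :
    A.cpx.d n n' (A.commutator h x y) =
      A.commutator h₁ (A.cpx.d p p' x) y + p.negOnePow • A.commutator h₂ x (A.cpx.d q q' y) := by
  have e₁ : (p * q).negOnePow = (p' * q).negOnePow * q.negOnePow := by
    rw [← Int.negOnePow_add, ← hp]; congr 1; ring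
  have e₂ : (p * q).negOnePow = (p * q').negOnePow * p.negOnePow := by
    rw [← Int.negOnePow_add, ← hq]; congr 1; ring
  have e₃ : (p * q).negOnePow * q.negOnePow = (p' * q).negOnePow := by
    rw [e₁, _root_.mul_assoc, ← Int.negOnePow_add, Int.negOnePow_even _ ⟨q, rfl⟩, _root_.mul_one]
  rw [A.commutator_apply h (by omega), A.commutator_apply h₁ (by omega),
    A.commutator_apply h₂ (by omega), map_sub, map_sign_smul, A.d_mul h h₁ h₂ hp hq,
    A.d_mul _ (by omega : q' + p = n') (by omega : q + p' = n') hq hp, smul_add, smul_smul, e₃,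
    smul_sub, smul_smul, e₂, mul_comm p.negOnePow]
  abel

lemma DGA.commutator_jacobi {K : Type u} [Field K] (A : DGA K) {p q r pq qr rp n : ℤ}
    (hpq : p + q = pq) (hqr : q + r = qr) (hrp : r + p = rp)
    (h₁ : p + qr = n) (h₂ : q + rp = n) (h₃ : r + pq = n)
    (x : A.cpx.X p) (y : A.cpx.X q) (z : A.cpx.X r) :
    A.commutator h₁ x (A.commutator hqr y z) +
      (p * (q + r)).negOnePow • A.commutator h₂ y (A.commutator hrp z x) +
      (r * (p + q)).negOnePow • A.commutator h₃ z (A.commutator hpq x y) = 0 := by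
  have eqr : r + q = qr := by omega
  have erp : p + r = rp := by omega
  have epq : q + p = pq := by omega
  rw [A.commutator_apply h₁ (by omega), A.commutator_apply h₂ (by omega),
    A.commutator_apply h₃ (by omega), A.commutator_apply hqr eqr, A.commutator_apply hrp erp,
    A.commutator_apply hpq epq]
  simp only [map_sub, LinearMap.sub_apply, map_sign_smul, sign_smul_apply]
  rw [A.mul_assoc hqr hrp (by omega) h₂, A.mul_assoc eqr epq (by omega) h₃,
    A.mul_assoc hrp hpq (by omega) h₃, A.mul_assoc erp eqr (by omega) h₁,
    A.mul_assoc hpq hqr (by omega) h₁, A.mul_assoc epq erp (by omega) h₂]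
  subst hpq hqr hrp
  simp only [mul_add, Int.negOnePow_add, mul_comm r p, mul_comm q p, mul_comm r q]
  obtain a | a := Int.units_eq_one_or (p * q).negOnePow <;>
  obtain b | b := Int.units_eq_one_or (p * r).negOnePow <;>
  obtain c | c := Int.units_eq_one_or (q * r).negOnePow <;>
  simp only [a, b, c, one_smul, _root_.mul_one, Units.neg_smul, mul_neg, neg_neg] <;>
  abel

lemma DGA.commutator_antisymm {K : Type u} [Field K] (A : DGA K) {p q n : ℤ} (h : p + q = n)
    (h' : q + p = n) (x : A.cpx.X p) (y : A.cpx.X q) :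
    A.commutator h x y = -((p * q).negOnePow • A.commutator h' y x) := by
  rw [A.commutator_apply h h', A.commutator_apply h' h, mul_comm q p]
  obtain e | e := Int.units_eq_one_or (p * q).negOnePow <;>
  simp only [e, one_smul, Units.neg_smul] <;> abel

lemma DGA.commutator_one {K : Type u} [Field K] (A : DGA K) {p n : ℤ} (h : p + 0 = n)
    (x : A.cpx.X p) : A.commutator h x A.one = 0 := by
  obtain rfl : p = n := by omega
  rw [A.commutator_apply h (by omega), A.mul_one, A.one_mul]
  simp

lemma DGA.Hom.map_commutator {K : Type u} [Field K] {A B : DGA K} (f : A.Hom B) {p q n : ℤ}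
    (h : p + q = n) (x : A.cpx.X p) (y : A.cpx.X q) :
    f.hom.f n (A.commutator h x y) = B.commutator h (f.hom.f p x) (f.hom.f q y) := by
  rw [DGA.commutator_apply _ h (by omega), DGA.commutator_apply _ h (by omega), ← f.map_mul,
    ← f.map_mul, map_sub, map_sign_smul]

/-- The functor from differential graded algebras to unital Lie algebras
which takes the graded commutator as Lie bracket. -/
def phiStar (K : Type u) [Field K] : DGA K ⥤ ULie K where
  obj A :=
    { cpx := A.cpx
      bracket := A.commutator
      unit := A.one
      d_bracket := A.commutator_leibniz
      d_unit := A.d_one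
      bracket_antisymm := A.commutator_antisymm
      jacobi := A.commutator_jacobi
      bracket_unit := A.commutator_one }
  map f :=
    { hom := f.hom
      map_bracket := f.map_commutator
      map_unit := f.map_one }

/-- The inclusion of the degree `p` part of `V` into the tensor algebra of `V`. -/
def ULie.tgen {K : Type u} [Field K] (V : ULie K) (p : ℤ) :
    V.cpx.X p →ₗ[K] TensorAlgebra K (DirectSum ℤ fun n => V.cpx.X n) :=
  (TensorAlgebra.ι K).comp (DirectSum.lof K ℤ (fun n => V.cpx.X n) p)

/-- The relations of the unital universal enveloping algebra: the graded commutator of two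
generators is their Lie bracket, and the unit of `V` is the unit of the tensor algebra. -/
inductive ULie.Rel {K : Type u} [Field K] (V : ULie K) :
    TensorAlgebra K (DirectSum ℤ fun n => V.cpx.X n) →
      TensorAlgebra K (DirectSum ℤ fun n => V.cpx.X n) → Prop
  | bracket {p q n : ℤ} (h : p + q = n) (x : V.cpx.X p) (y : V.cpx.X q) :
      ULie.Rel V
        (V.tgen p x * V.tgen q y - (p * q).negOnePow • (V.tgen q y * V.tgen p x))
        (V.tgen n (V.bracket h x y))
  | unit : ULie.Rel V (V.tgen 0 V.unit) 1

/-- The algebra underlying the unital universal enveloping algebra: the quotient of the tensor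
algebra by the two-sided ideal generated by the relations. -/
def ULie.Env {K : Type u} [Field K] (V : ULie K) : Type u := RingQuot V.Rel

instance ULie.Env.ring {K : Type u} [Field K] (V : ULie K) : Ring V.Env :=
  inferInstanceAs (Ring (RingQuot V.Rel))

instance ULie.Env.algebra {K : Type u} [Field K] (V : ULie K) : Algebra K V.Env :=
  inferInstanceAs (Algebra K (RingQuot V.Rel))

/-- The projection of the tensor algebra onto the enveloping algebra. -/
def ULie.Env.mk {K : Type u} [Field K] (V : ULie K) :
    TensorAlgebra K (DirectSum ℤ fun n => V.cpx.X n) →ₐ[K] V.Env :=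
  RingQuot.mkAlgHom K V.Rel

/-- The canonical map from the degree `p` part of `V` to the enveloping algebra. -/
def ULie.gen {K : Type u} [Field K] (V : ULie K) (p : ℤ) : V.cpx.X p →ₗ[K] V.Env :=
  (ULie.Env.mk V).toLinearMap.comp (V.tgen p)

lemma ULie.gen_bracket {K : Type u} [Field K] (V : ULie K) {p q n : ℤ} (h : p + q = n)
    (x : V.cpx.X p) (y : V.cpx.X q) :
    V.gen n (V.bracket h x y) =
      V.gen p x * V.gen q y - (p * q).negOnePow • (V.gen q y * V.gen p x) := by
  have := RingQuot.mkAlgHom_rel K (ULie.Rel.bracket (V := V) h x y)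
  change ULie.Env.mk V _ = ULie.Env.mk V _ at this
  rw [map_sub, map_sign_smul, map_mul, map_mul] at this
  exact this.symm

lemma ULie.gen_unit {K : Type u} [Field K] (V : ULie K) : V.gen 0 V.unit = 1 := by
  have := RingQuot.mkAlgHom_rel K (ULie.Rel.unit (V := V))
  change ULie.Env.mk V _ = ULie.Env.mk V _ at this
  rw [map_one] at this
  exact this

lemma ULie.Env.induction {K : Type u} [Field K] (V : ULie K) {P : V.Env → Prop}
    (scalar : ∀ k : K, P (algebraMap K V.Env k)) (gen : ∀ p x, P (V.gen p x))
    (mul : ∀ a b, P a → P b → P (a * b)) (add : ∀ a b, P a → P b → P (a + b)) (a : V.Env) :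
    P a := by
  obtain ⟨t, rfl⟩ := RingQuot.mkAlgHom_surjective K V.Rel a
  change P (ULie.Env.mk V t)
  induction t using TensorAlgebra.induction with
  | algebraMap k => rw [AlgHom.commutes]; exact scalar k
  | ι m =>
    induction m using DirectSum.induction_on with
    | zero => simpa using scalar 0
    | of p x => exact gen p x
    | add x y hx hy => rw [map_add, map_add]; exact add _ _ hx hy
  | mul a b ha hb => rw [map_mul]; exact mul _ _ ha hb
  | add a b ha hb => rw [map_add]; exact add _ _ ha hb

/-- Algebra homomorphisms out of the enveloping algebra. -/
def ULie.Env.lift {K : Type u} [Field K] (V : ULie K) {B : Type v} [Ring B] [Algebra K B]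
    (g : ∀ p, V.cpx.X p →ₗ[K] B)
    (hb : ∀ {p q n : ℤ} (h : p + q = n) (x : V.cpx.X p) (y : V.cpx.X q),
      g n (V.bracket h x y) = g p x * g q y - (p * q).negOnePow • (g q y * g p x))
    (hu : g 0 V.unit = 1) : V.Env →ₐ[K] B :=
  RingQuot.liftAlgHom K ⟨TensorAlgebra.lift K (DirectSum.toModule K ℤ B g), by
    intro a b r
    cases r with
    | bracket h x y => 
      rw [map_sub, map_sign_smul, map_mul, map_mul]
      simp only [ULie.tgen, LinearMap.comp_apply, TensorAlgebra.lift_ι_apply,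
        DirectSum.toModule_lof, hb h]
    | unit =>
      simp only [ULie.tgen, LinearMap.comp_apply, TensorAlgebra.lift_ι_apply,
        DirectSum.toModule_lof, hu, map_one]⟩

lemma ULie.Env.lift_gen {K : Type u} [Field K] (V : ULie K) {B : Type v} [Ring B] [Algebra K B]
    (g : ∀ p, V.cpx.X p →ₗ[K] B)
    (hb : ∀ {p q n : ℤ} (h : p + q = n) (x : V.cpx.X p) (y : V.cpx.X q),
      g n (V.bracket h x y) = g p x * g q y - (p * q).negOnePow • (g q y * g p x))
    (hu : g 0 V.unit = 1) (p : ℤ) (x : V.cpx.X p) :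
    ULie.Env.lift V g hb hu (V.gen p x) = g p x := by
  change RingQuot.liftAlgHom K _ (RingQuot.mkAlgHom K V.Rel _) = _
  rw [RingQuot.liftAlgHom_mkAlgHom_apply]
  simp only [ULie.tgen, LinearMap.comp_apply, TensorAlgebra.lift_ι_apply, DirectSum.toModule_lof]

/-- `V.IsWord n a` says that `a` is a product `v₁ ⋯ vₖ` (`k ≥ 0`) of homogeneous elements of `V`
whose degrees add up to `n`. -/
inductive ULie.IsWord {K : Type u} [Field K] (V : ULie K) : ℤ → V.Env → Prop
  | one : ULie.IsWord V 0 1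
  | cons {p q n : ℤ} (h : p + q = n) (x : V.cpx.X p) {a : V.Env} (_ : ULie.IsWord V q a) :
      ULie.IsWord V n (V.gen p x * a)

/-- The degree `n` part of the enveloping algebra. -/
def ULie.grade {K : Type u} [Field K] (V : ULie K) (n : ℤ) : Submodule K V.Env :=
  Submodule.span K {a | V.IsWord n a}

lemma ULie.IsWord.mem_grade {K : Type u} [Field K] {V : ULie K} {n : ℤ} {a : V.Env}
    (h : V.IsWord n a) : a ∈ V.grade n := Submodule.subset_span h

lemma ULie.grade_le {K : Type u} [Field K] (V : ULie K) {n : ℤ} {S : Submodule K V.Env}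
    (h : ∀ a, V.IsWord n a → a ∈ S) : V.grade n ≤ S := Submodule.span_le.2 h

lemma ULie.one_mem_grade {K : Type u} [Field K] (V : ULie K) : (1 : V.Env) ∈ V.grade 0 :=
  ULie.IsWord.one.mem_grade

lemma ULie.gen_mem_grade {K : Type u} [Field K] (V : ULie K) (p : ℤ) (x : V.cpx.X p) :
    V.gen p x ∈ V.grade p := by
  simpa using (ULie.IsWord.cons (add_zero p) x ULie.IsWord.one).mem_grade

lemma ULie.gen_mul_mem_grade {K : Type u} [Field K] (V : ULie K) {p q n : ℤ} (h : p + q = n)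
    (x : V.cpx.X p) {b : V.Env} (hb : b ∈ V.grade q) : V.gen p x * b ∈ V.grade n :=
  V.grade_le (S := (V.grade n).comap (LinearMap.mulLeft K (V.gen p x)))
    (fun _ hw => (ULie.IsWord.cons h x hw).mem_grade) hb

lemma ULie.mul_mem_grade {K : Type u} [Field K] (V : ULie K) {p q n : ℤ} (h : p + q = n)
    {a b : V.Env} (ha : a ∈ V.grade p) (hb : b ∈ V.grade q) : a * b ∈ V.grade n := by
  refine V.grade_le (S := (V.grade n).comap (LinearMap.mulRight K b)) (fun w hw => ?_) ha
  change w * b ∈ V.grade n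
  clear ha a
  induction hw generalizing n with
  | one => rw [one_mul]; obtain rfl : q = n := by omega
           exact hb
  | cons h' x _ ih =>
    rw [mul_assoc]
    exact V.gen_mul_mem_grade (by rw [← h, ← h', add_assoc]) x (ih rfl)

/-- The endomorphism `(a, b) ↦ (d x * b + (-1)^p x * a, x * b)` of `Env × Env` for `x` of degree `p`,
an auxiliary construction for the extension of the differential to a graded derivation. -/
def ULie.diffAux {K : Type u} [Field K] (V : ULie K) (p : ℤ) :
    V.cpx.X p →ₗ[K] Module.End K (V.Env × V.Env) :=
  LinearMap.mk₂ K
    (fun x ab => (V.gen (p - 1) (V.cpx.d p (p - 1) x) * ab.2 + p.negOnePow • (V.gen p x * ab.1),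
      V.gen p x * ab.2))
    (fun x y ab => by
      ext <;> simp only [map_add, add_mul, smul_add, Prod.mk_add_mk]
      abel)
    (fun c x ab => by
      ext <;> simp [smul_comm c])
    (fun x ab ab' => by
      ext <;> simp only [mul_add, smul_add, Prod.mk_add_mk, Prod.fst_add, Prod.snd_add]
      abel)
    (fun c x ab => by
      ext <;> simp [smul_comm c])

lemma ULie.diffAux_apply {K : Type u} [Field K] (V : ULie K) {p p' : ℤ} (hp : p' + 1 = p)
    (x : V.cpx.X p) (a b : V.Env) :
    V.diffAux p x (a, b) = (V.gen p' (V.cpx.d p p' x) * b + p.negOnePow • (V.gen p x * a),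
      V.gen p x * b) := by
  obtain rfl : p' = p - 1 := by omega
  rfl

lemma sign_mul_left {A : Type*} [Ring A] (e : ℤˣ) (a b : A) : (e • a) * b = e • (a * b) := by
  obtain rfl | rfl := Int.units_eq_one_or e <;> simp

lemma sign_mul_right {A : Type*} [Ring A] (e : ℤˣ) (a b : A) : a * (e • b) = e • (a * b) := by
  obtain rfl | rfl := Int.units_eq_one_or e <;> simp

lemma ULie.diffAux_bracket {K : Type u} [Field K] (V : ULie K) {p q n : ℤ} (h : p + q = n)
    (x : V.cpx.X p) (y : V.cpx.X q) :
    V.diffAux n (V.bracket h x y) = V.diffAux p x * V.diffAux q y -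
      (p * q).negOnePow • (V.diffAux q y * V.diffAux p x) := by
  obtain ⟨p', hp⟩ : ∃ p', p' + 1 = p := ⟨p - 1, by omega⟩
  obtain ⟨q', hq⟩ : ∃ q', q' + 1 = q := ⟨q - 1, by omega⟩
  obtain ⟨n', hn⟩ : ∃ n', n' + 1 = n := ⟨n - 1, by omega⟩
  have e₁ : (p * q).negOnePow = (p' * q).negOnePow * q.negOnePow := by
    rw [← Int.negOnePow_add, ← hp]; congr 1; ring
  have e₂ : (p * q).negOnePow = (p * q').negOnePow * p.negOnePow := by
    rw [← Int.negOnePow_add, ← hq]; congr 1; ring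
  have e₃ : n.negOnePow = p.negOnePow * q.negOnePow := by rw [← h, Int.negOnePow_add]
  have e₄ : (p' * q).negOnePow = (p * q).negOnePow * q.negOnePow := by
    rw [e₁, mul_assoc, Int.units_mul_self, mul_one]
  have e₅ : (p * q').negOnePow = (p * q).negOnePow * p.negOnePow := by
    rw [e₂, mul_assoc, Int.units_mul_self, mul_one]
  refine LinearMap.ext fun ⟨a, b⟩ => ?_
  rw [LinearMap.sub_apply, sign_smul_apply, Module.End.mul_apply, Module.End.mul_apply,
    V.diffAux_apply hn, V.diffAux_apply hp, V.diffAux_apply hq, V.diffAux_apply hp,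
    V.diffAux_apply hq, V.d_bracket h (by omega : p' + q = n') (by omega) hp hq, map_add,
    map_sign_smul, V.gen_bracket, V.gen_bracket, V.gen_bracket]
  ext
  · simp only [Prod.fst_sub, Prod.smul_fst, e₃, e₄, e₅]
    obtain i | i := Int.units_eq_one_or p.negOnePow <;>
    obtain j | j := Int.units_eq_one_or q.negOnePow <;>
    obtain k | k := Int.units_eq_one_or (p * q).negOnePow <;>
    simp only [i, j, k, one_smul, mul_one, Units.neg_smul, mul_neg, neg_neg] <;>
    noncomm_ring
  · simp only [Prod.snd_sub, Prod.smul_snd, sub_mul, sign_mul_left, mul_assoc]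

/-- The algebra homomorphism `a ↦ ((c, b) ↦ (d a * b + ± a * c, a * b))`. -/
def ULie.diffHom {K : Type u} [Field K] (V : ULie K) : V.Env →ₐ[K] Module.End K (V.Env × V.Env) :=
  ULie.Env.lift V V.diffAux V.diffAux_bracket (by
    refine LinearMap.ext fun ⟨a, b⟩ => ?_
    rw [V.diffAux_apply (by omega : (-1 : ℤ) + 1 = 0), V.d_unit, V.gen_unit]
    simp)

/-- The differential of the enveloping algebra: the unique graded derivation which extends
the differential of `V`. -/
def ULie.diff {K : Type u} [Field K] (V : ULie K) : V.Env →ₗ[K] V.Env :=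
  (LinearMap.fst K V.Env V.Env).comp
    ((LinearMap.applyₗ ((0, 1) : V.Env × V.Env)).comp V.diffHom.toLinearMap)

lemma ULie.diffHom_snd {K : Type u} [Field K] (V : ULie K) (a c b : V.Env) :
    (V.diffHom a (c, b)).2 = a * b := by
  induction a using ULie.Env.induction generalizing c b with
  | scalar k => rw [AlgHom.commutes]; simp [Algebra.smul_def]
  | gen p x => 
    rw [ULie.diffHom, ULie.Env.lift_gen, V.diffAux_apply (by omega : (p - 1) + 1 = p)]
  | mul a a' h h' =>
    rw [map_mul, Module.End.mul_apply, mul_assoc, ← h' c b]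
    exact h _ _
  | add a a' h h' => rw [map_add, LinearMap.add_apply, Prod.snd_add, h, h', add_mul]

lemma ULie.diffHom_apply {K : Type u} [Field K] (V : ULie K) (a : V.Env) :
    V.diffHom a (0, 1) = (V.diff a, a) := by
  ext
  · rfl
  · rw [V.diffHom_snd, mul_one]

lemma ULie.diff_one {K : Type u} [Field K] (V : ULie K) : V.diff 1 = 0 := by
  change (V.diffHom 1 (0, 1)).1 = 0
  rw [map_one]; rfl

lemma ULie.diff_gen_mul {K : Type u} [Field K] (V : ULie K) {p p' : ℤ} (hp : p' + 1 = p)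
    (x : V.cpx.X p) (a : V.Env) :
    V.diff (V.gen p x * a) =
      V.gen p' (V.cpx.d p p' x) * a + p.negOnePow • (V.gen p x * V.diff a) := by
  change (V.diffHom (V.gen p x * a) (0, 1)).1 = _
  rw [map_mul, Module.End.mul_apply, V.diffHom_apply, ULie.diffHom, ULie.Env.lift_gen,
    V.diffAux_apply hp]

lemma ULie.diff_gen {K : Type u} [Field K] (V : ULie K) {p p' : ℤ} (hp : p' + 1 = p)
    (x : V.cpx.X p) : V.diff (V.gen p x) = V.gen p' (V.cpx.d p p' x) := by
  simpa [V.diff_one] using V.diff_gen_mul hp x 1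

lemma ULie.diff_mem_grade {K : Type u} [Field K] (V : ULie K) {n n' : ℤ} (hn : n' + 1 = n)
    {a : V.Env} (ha : a ∈ V.grade n) : V.diff a ∈ V.grade n' := by
  refine V.grade_le (S := (V.grade n').comap V.diff) (fun w hw => ?_) ha
  change V.diff w ∈ V.grade n'
  clear ha a
  induction hw generalizing n' with
  | one => rw [V.diff_one]; exact zero_mem _
  | @cons p q n h x a hw ih =>
    rw [V.diff_gen_mul (by omega : (p - 1) + 1 = p)]
    refine add_mem (V.gen_mul_mem_grade (by omega) _ hw.mem_grade) ?_
    have := V.gen_mul_mem_grade (by omega : p + (q - 1) = n') x (ih (n' := q - 1) (by omega))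
    obtain e | e := Int.units_eq_one_or p.negOnePow
    · simpa [e] using this
    · simpa [e] using this

lemma ULie.diff_mul {K : Type u} [Field K] (V : ULie K) {p : ℤ} {a : V.Env} (ha : a ∈ V.grade p)
    (b : V.Env) : V.diff (a * b) = V.diff a * b + p.negOnePow • (a * V.diff b) := by
  induction ha using Submodule.span_induction with
  | mem w hw =>
    induction hw with
    | one => simp [V.diff_one]
    | @cons p q n h x a hw ih =>
      have hp : (p - 1) + 1 = p := by omega
      rw [mul_assoc, V.diff_gen_mul hp, V.diff_gen_mul hp, ih, add_mul, mul_add, smul_add,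
        sign_mul_left, sign_mul_right, smul_smul, ← Int.negOnePow_add, h, mul_assoc, mul_assoc,
        mul_assoc, add_assoc]
  | zero => simp
  | add x y _ _ hx hy =>
    rw [add_mul, map_add, map_add, hx, hy, add_mul, add_mul, smul_add]
    abel
  | smul c x _ hx =>
    rw [smul_mul_assoc, map_smul, map_smul, hx, smul_mul_assoc, smul_mul_assoc, smul_add,
      smul_comm c]

lemma ULie.diff_diff {K : Type u} [Field K] (V : ULie K) {n : ℤ} {a : V.Env}
    (ha : a ∈ V.grade n) : V.diff (V.diff a) = 0 := by
  refine V.grade_le (S := LinearMap.ker (V.diff.comp V.diff)) (fun w hw => ?_) ha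
  change V.diff (V.diff w) = 0
  clear ha a
  induction hw with
  | one => rw [V.diff_one, map_zero]
  | @cons p q n h x a hw ih =>
    have hp : (p - 1) + 1 = p := by omega
    have hp' : (p - 2) + 1 = p - 1 := by omega
    have hd : V.cpx.d (p - 1) (p - 2) (V.cpx.d p (p - 1) x) = 0 := by
      rw [← ModuleCat.comp_apply, V.cpx.d_comp_d]; rfl
    have he : p.negOnePow = -(p - 1).negOnePow := by rw [← Int.negOnePow_succ, hp]
    rw [V.diff_gen_mul hp, map_add, map_sign_smul, V.diff_gen_mul hp', V.diff_gen_mul hp, ih, hd,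
      map_zero, mul_zero, smul_zero, zero_mul, he, Units.neg_smul]
    simp

/-- The chain complex underlying the unital universal enveloping algebra. -/
def ULie.envCpx {K : Type u} [Field K] (V : ULie K) : Ch K where
  X n := ModuleCat.of K (V.grade n)
  d i j := if h : j + 1 = i then
      ModuleCat.ofHom (V.diff.restrict (p := V.grade i) (q := V.grade j)
        (fun _ ha => V.diff_mem_grade h ha))
    else 0
  shape i j h := dif_neg h
  d_comp_d' i j k hij hjk := by
    rw [dif_pos (show j + 1 = i from hij), dif_pos (show k + 1 = j from hjk)]
    ext x
    exact V.diff_diff x.2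

/-- The inclusion of the degree `n` part of the enveloping algebra. -/
def ULie.val {K : Type u} [Field K] (V : ULie K) (n : ℤ) : V.envCpx.X n →ₗ[K] V.Env :=
  (V.grade n).subtype

lemma ULie.val_injective {K : Type u} [Field K] (V : ULie K) (n : ℤ) :
    Function.Injective (V.val n) := Subtype.val_injective

lemma ULie.val_mem {K : Type u} [Field K] (V : ULie K) {n : ℤ} (x : V.envCpx.X n) :
    V.val n x ∈ V.grade n := Subtype.prop (p := (· ∈ V.grade n)) x

/-- A homogeneous element of the enveloping algebra, as an element of the chain complex. -/
def ULie.toCpx {K : Type u} [Field K] (V : ULie K) {n : ℤ} (a : V.Env) (h : a ∈ V.grade n) :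
    V.envCpx.X n := (⟨a, h⟩ : V.grade n)

lemma ULie.val_toCpx {K : Type u} [Field K] (V : ULie K) {n : ℤ} (a : V.Env)
    (h : a ∈ V.grade n) : V.val n (V.toCpx a h) = a := rfl

lemma ULie.val_d {K : Type u} [Field K] (V : ULie K) {i j : ℤ} (h : j + 1 = i)
    (x : V.envCpx.X i) : V.val j (V.envCpx.d i j x) = V.diff (V.val i x) := by
  have : V.envCpx.d i j = ModuleCat.ofHom (V.diff.restrict (p := V.grade i) (q := V.grade j)
        (fun _ ha => V.diff_mem_grade h ha)) := dif_pos h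
  rw [this]; rfl

/-- The multiplication of homogeneous elements of the enveloping algebra. -/
def ULie.envMul {K : Type u} [Field K] (V : ULie K) {p q n : ℤ} (h : p + q = n) :
    V.envCpx.X p →ₗ[K] V.envCpx.X q →ₗ[K] V.envCpx.X n :=
  LinearMap.mk₂ K
    (fun x y => V.toCpx (V.val p x * V.val q y) (V.mul_mem_grade h (V.val_mem x) (V.val_mem y)))
    (fun _ _ _ => Subtype.ext (add_mul _ _ _)) (fun _ _ _ => Subtype.ext (smul_mul_assoc _ _ _))
    (fun _ _ _ => Subtype.ext (mul_add _ _ _)) (fun _ _ _ => Subtype.ext (mul_smul_comm _ _ _))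

lemma ULie.val_envMul {K : Type u} [Field K] (V : ULie K) {p q n : ℤ} (h : p + q = n)
    (x : V.envCpx.X p) (y : V.envCpx.X q) : V.val n (V.envMul h x y) = V.val p x * V.val q y := rfl

/-- The unital universal enveloping algebra of a unital Lie algebra in `Ch(K)`. -/
def ULie.env {K : Type u} [Field K] (V : ULie K) : DGA K where
  cpx := V.envCpx
  mul := V.envMul
  one := V.toCpx 1 V.one_mem_grade
  d_mul {p q n p' q' n'} h h₁ h₂ hp hq x y := V.val_injective n' (by
    rw [V.val_d (by omega), V.val_envMul, V.diff_mul (V.val_mem x), map_add, map_sign_smul,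
      V.val_envMul, V.val_envMul, V.val_d hp, V.val_d hq])
  d_one := V.val_injective _ (by
    rw [V.val_d (by omega), V.val_toCpx, V.diff_one, map_zero])
  one_mul _ x := V.val_injective _ (by rw [V.val_envMul, V.val_toCpx, _root_.one_mul])
  mul_one _ x := V.val_injective _ (by rw [V.val_envMul, V.val_toCpx, _root_.mul_one])
  mul_assoc _ _ _ _ x y z := V.val_injective _ (by
    rw [V.val_envMul, V.val_envMul, V.val_envMul, V.val_envMul, _root_.mul_assoc])

/-- The canonical chain map from a unital Lie algebra to its enveloping algebra. -/
def ULie.toEnvCpx {K : Type u} [Field K] (V : ULie K) : V.cpx ⟶ V.envCpx where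
  f n := ModuleCat.ofHom ((V.gen n).codRestrict (V.grade n) (V.gen_mem_grade n))
  comm' := by
    intro i j hij
    ext x
    refine V.val_injective j ?_
    exact (V.val_d hij _).trans (V.diff_gen hij x)

lemma ULie.val_toEnvCpx {K : Type u} [Field K] (V : ULie K) {n : ℤ} (x : V.cpx.X n) :
    V.val n (V.toEnvCpx.f n x) = V.gen n x := rfl

lemma ULie.env_induction {K : Type u} [Field K] (V : ULie K)
    {P : ∀ n, V.envCpx.X n → Prop} (one : P 0 (V.toCpx 1 V.one_mem_grade))
    (gen_mul : ∀ {p q n : ℤ} (h : p + q = n) (x : V.cpx.X p) (a : V.envCpx.X q),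
      P q a → P n (V.envMul h (V.toEnvCpx.f p x) a))
    (zero : ∀ n, P n 0)
    (add : ∀ n (a b : V.envCpx.X n), P n a → P n b → P n (a + b))
    (smul : ∀ n (c : K) (a : V.envCpx.X n), P n a → P n (c • a)) (n : ℤ) (a : V.envCpx.X n) :
    P n a := by
  have key : ∀ w (hw : w ∈ V.grade n), P n (V.toCpx w hw) := by
    clear a
    intro w₀ hw₀
    refine Submodule.span_induction (p := fun w hw => P n (V.toCpx w hw)) ?_ (zero n)
      (fun _ _ _ _ ha hb => add n _ _ ha hb) (fun c _ _ ha => smul n c _ ha) hw₀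
    clear hw₀ w₀
    intro w hw
    induction hw with
    | one => exact one
    | cons h x hw ih => exact gen_mul h x _ ih
  exact key (V.val n a) (V.val_mem a)

/-- The canonical morphism from a unital Lie algebra to its enveloping algebra. -/
def ULie.toEnv {K : Type u} [Field K] (V : ULie K) : V ⟶ (phiStar K).obj V.env where
  hom := V.toEnvCpx
  map_bracket := by
    intro p q n h x y
    have h' : q + p = n := by omega
    refine V.val_injective n ?_
    refine (V.gen_bracket h x y).trans ?_
    refine Eq.trans ?_ (congrArg (V.val n) (V.env.commutator_apply h h' (V.toEnvCpx.f p x)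
      (V.toEnvCpx.f q y)).symm)
    change _ = V.val n (V.envMul h _ _ - (p * q).negOnePow • V.envMul h' _ _)
    rw [map_sub, map_sign_smul, V.val_envMul, V.val_envMul]
    rfl
  map_unit := V.val_injective 0 V.gen_unit

/-- Left multiplication by an element of degree `p` of a differential graded algebra on the direct
sum of its homogeneous parts. -/
def DGA.leftMul {K : Type u} [Field K] (A : DGA K) (p : ℤ) :
    A.cpx.X p →ₗ[K] Module.End K (DirectSum ℤ fun n => A.cpx.X n) :=
  LinearMap.flip (DirectSum.toModule K ℤ _ fun q =>
    LinearMap.flip ((A.mul (rfl : p + q = p + q)).compr₂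
      (DirectSum.lof K ℤ (fun n => A.cpx.X n) (p + q))))

lemma DGA.leftMul_lof {K : Type u} [Field K] (A : DGA K) {p q n : ℤ} (h : p + q = n)
    (x : A.cpx.X p) (y : A.cpx.X q) :
    A.leftMul p x (DirectSum.lof K ℤ (fun n => A.cpx.X n) q y) =
      DirectSum.lof K ℤ (fun n => A.cpx.X n) n (A.mul h x y) := by
  subst h
  simp [DGA.leftMul]

lemma DGA.leftMul_mul {K : Type u} [Field K] (A : DGA K) {p q n : ℤ} (h : p + q = n)
    (x : A.cpx.X p) (y : A.cpx.X q) :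
    A.leftMul n (A.mul h x y) = A.leftMul p x * A.leftMul q y := by
  refine DirectSum.linearMap_ext K fun r => LinearMap.ext fun z => ?_
  simp only [LinearMap.comp_apply, Module.End.mul_apply]
  rw [A.leftMul_lof rfl, A.leftMul_lof rfl, A.leftMul_lof (by rw [← h, add_assoc] : p + (q + r) = n + r),
    A.mul_assoc h rfl]

lemma DGA.leftMul_one {K : Type u} [Field K] (A : DGA K) : A.leftMul 0 A.one = 1 := by
  refine DirectSum.linearMap_ext K fun r => LinearMap.ext fun z => ?_
  simp only [LinearMap.comp_apply, Module.End.one_apply]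
  rw [A.leftMul_lof (zero_add r), A.one_mul]

/-- The value at `1` of an endomorphism, projected to degree `n`. -/
def DGA.evalOne {K : Type u} [Field K] (A : DGA K) (n : ℤ) :
    Module.End K (DirectSum ℤ fun n => A.cpx.X n) →ₗ[K] A.cpx.X n :=
  (DirectSum.component K ℤ (fun n => A.cpx.X n) n).comp
    (LinearMap.applyₗ (DirectSum.lof K ℤ (fun n => A.cpx.X n) 0 A.one))

lemma DGA.evalOne_leftMul {K : Type u} [Field K] (A : DGA K) (n : ℤ) (x : A.cpx.X n) :
    A.evalOne n (A.leftMul n x) = x := by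
  simp only [DGA.evalOne, LinearMap.comp_apply, LinearMap.applyₗ_apply_apply]
  rw [A.leftMul_lof (add_zero n), A.mul_one, DirectSum.component.lof_self]

lemma DGA.leftMul_injective {K : Type u} [Field K] (A : DGA K) (n : ℤ) :
    Function.Injective (A.leftMul n) :=
  Function.LeftInverse.injective (A.evalOne_leftMul n)

lemma ULie.leftMul_bracket {K : Type u} [Field K] (V : ULie K) (A : DGA K) (f : V.cpx ⟶ A.cpx)
    (hb : ∀ {p q n : ℤ} (h : p + q = n) (x : V.cpx.X p) (y : V.cpx.X q),
      f.f n (V.bracket h x y) = A.commutator h (f.f p x) (f.f q y))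
    {p q n : ℤ} (h : p + q = n) (x : V.cpx.X p) (y : V.cpx.X q) :
    (A.leftMul n).comp (f.f n).hom (V.bracket h x y) =
      (A.leftMul p).comp (f.f p).hom x * (A.leftMul q).comp (f.f q).hom y -
        (p * q).negOnePow •
          ((A.leftMul q).comp (f.f q).hom y * (A.leftMul p).comp (f.f p).hom x) := by
  have h' : q + p = n := by omega
  simp only [LinearMap.comp_apply]
  rw [← A.leftMul_mul h, ← A.leftMul_mul h', ← map_sign_smul, ← map_sub, ← A.commutator_apply]
  exact congrArg _ (hb h x y)

/-- The algebra homomorphism induced by a morphism of unital Lie algebras `V ⟶ A`. -/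
def ULie.descHom {K : Type u} [Field K] (V : ULie K) (A : DGA K) (f : V.cpx ⟶ A.cpx)
    (hb : ∀ {p q n : ℤ} (h : p + q = n) (x : V.cpx.X p) (y : V.cpx.X q),
      f.f n (V.bracket h x y) = A.commutator h (f.f p x) (f.f q y))
    (hu : f.f 0 V.unit = A.one) :
    V.Env →ₐ[K] Module.End K (DirectSum ℤ fun n => A.cpx.X n) :=
  ULie.Env.lift V (fun p => (A.leftMul p).comp (f.f p).hom) (V.leftMul_bracket A f hb)
    ((congrArg (A.leftMul 0) hu).trans A.leftMul_one)

lemma ULie.descHom_gen {K : Type u} [Field K] (V : ULie K) (A : DGA K) (f : V.cpx ⟶ A.cpx)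
    (hb : ∀ {p q n : ℤ} (h : p + q = n) (x : V.cpx.X p) (y : V.cpx.X q),
      f.f n (V.bracket h x y) = A.commutator h (f.f p x) (f.f q y))
    (hu : f.f 0 V.unit = A.one) (p : ℤ) (x : V.cpx.X p) :
    V.descHom A f hb hu (V.gen p x) = A.leftMul p (f.f p x) :=
   ULie.Env.lift_gen V (fun p => (A.leftMul p).comp (f.f p).hom) (V.leftMul_bracket A f hb)
    _ p x

/-- The components of the morphism of differential graded algebras out of the enveloping algebra
induced by a morphism of unital Lie algebras `V ⟶ A`. -/
def ULie.descLin {K : Type u} [Field K] (V : ULie K) (A : DGA K) (f : V.cpx ⟶ A.cpx)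
    (hb : ∀ {p q n : ℤ} (h : p + q = n) (x : V.cpx.X p) (y : V.cpx.X q),
      f.f n (V.bracket h x y) = A.commutator h (f.f p x) (f.f q y))
    (hu : f.f 0 V.unit = A.one) (n : ℤ) : V.envCpx.X n →ₗ[K] A.cpx.X n :=
  (A.evalOne n).comp ((V.descHom A f hb hu).toLinearMap.comp (V.val n))

lemma ULie.leftMul_descLin {K : Type u} [Field K] (V : ULie K) (A : DGA K) (f : V.cpx ⟶ A.cpx)
    (hb : ∀ {p q n : ℤ} (h : p + q = n) (x : V.cpx.X p) (y : V.cpx.X q),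
      f.f n (V.bracket h x y) = A.commutator h (f.f p x) (f.f q y))
    (hu : f.f 0 V.unit = A.one) (n : ℤ) (a : V.envCpx.X n) :
    A.leftMul n (V.descLin A f hb hu n a) = V.descHom A f hb hu (V.val n a) := by
  suffices h : ∃ b, V.descHom A f hb hu (V.val n a) = A.leftMul n b by
    obtain ⟨b, h⟩ := h
    change A.leftMul n (A.evalOne n (V.descHom A f hb hu (V.val n a))) = _
    rw [h, A.evalOne_leftMul]
  induction n, a using V.env_induction with
  | one => exact ⟨A.one, by rw [V.val_toCpx, map_one, A.leftMul_one]⟩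
  | gen_mul h x a ih =>
    obtain ⟨b, ih⟩ := ih
    exact ⟨A.mul h (f.f _ x) b, by
      rw [V.val_envMul, map_mul, ih, A.leftMul_mul, V.val_toEnvCpx, V.descHom_gen]⟩
  | zero n => exact ⟨0, by simp⟩
  | add n a b ha hb =>
    obtain ⟨a', ha⟩ := ha
    obtain ⟨b', hb⟩ := hb
    exact ⟨a' + b', by simp only [map_add, ha, hb]⟩
  | smul n c a ha =>
    obtain ⟨a', ha⟩ := ha
    exact ⟨c • a', by simp only [map_smul, ha]⟩

lemma ULie.descLin_one {K : Type u} [Field K] (V : ULie K) (A : DGA K) (f : V.cpx ⟶ A.cpx)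
    (hb : ∀ {p q n : ℤ} (h : p + q = n) (x : V.cpx.X p) (y : V.cpx.X q),
      f.f n (V.bracket h x y) = A.commutator h (f.f p x) (f.f q y))
    (hu : f.f 0 V.unit = A.one) :
    V.descLin A f hb hu 0 (V.toCpx 1 V.one_mem_grade) = A.one :=
  A.leftMul_injective 0 (by
    rw [V.leftMul_descLin, V.val_toCpx, map_one, A.leftMul_one])

lemma ULie.descLin_mul {K : Type u} [Field K] (V : ULie K) (A : DGA K) (f : V.cpx ⟶ A.cpx)
    (hb : ∀ {p q n : ℤ} (h : p + q = n) (x : V.cpx.X p) (y : V.cpx.X q),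
      f.f n (V.bracket h x y) = A.commutator h (f.f p x) (f.f q y))
    (hu : f.f 0 V.unit = A.one) {p q n : ℤ} (h : p + q = n) (x : V.envCpx.X p)
    (y : V.envCpx.X q) :
    V.descLin A f hb hu n (V.envMul h x y) =
      A.mul h (V.descLin A f hb hu p x) (V.descLin A f hb hu q y) :=
  A.leftMul_injective n (by
    rw [V.leftMul_descLin, V.val_envMul, map_mul, A.leftMul_mul, V.leftMul_descLin,
      V.leftMul_descLin])

lemma ULie.descLin_toEnvCpx {K : Type u} [Field K] (V : ULie K) (A : DGA K) (f : V.cpx ⟶ A.cpx)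
    (hb : ∀ {p q n : ℤ} (h : p + q = n) (x : V.cpx.X p) (y : V.cpx.X q),
      f.f n (V.bracket h x y) = A.commutator h (f.f p x) (f.f q y))
    (hu : f.f 0 V.unit = A.one) {p : ℤ} (x : V.cpx.X p) :
    V.descLin A f hb hu p (V.toEnvCpx.f p x) = f.f p x :=
  A.leftMul_injective p (by
    rw [V.leftMul_descLin, V.val_toEnvCpx, V.descHom_gen])

lemma ULie.descLin_d {K : Type u} [Field K] (V : ULie K) (A : DGA K) (f : V.cpx ⟶ A.cpx)
    (hb : ∀ {p q n : ℤ} (h : p + q = n) (x : V.cpx.X p) (y : V.cpx.X q),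
      f.f n (V.bracket h x y) = A.commutator h (f.f p x) (f.f q y))
    (hu : f.f 0 V.unit = A.one) {n n' : ℤ} (hn : n' + 1 = n) (a : V.envCpx.X n) :
    V.descLin A f hb hu n' (V.envCpx.d n n' a) = A.cpx.d n n' (V.descLin A f hb hu n a) := by
  induction n, a using V.env_induction generalizing n' with
  | one =>
    obtain rfl : n' = -1 := by omega
    rw [V.descLin_one, A.d_one]
    exact (congrArg _ V.env.d_one).trans (map_zero _)
  | @gen_mul p q n h x a ih =>
    have hp : (p - 1) + 1 = p := by omega
    have hq : (q - 1) + 1 = q := by omega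
    have h₁ : (p - 1) + q = n' := by omega
    have h₂ : p + (q - 1) = n' := by omega
    have e := V.env.d_mul h h₁ h₂ hp hq
      (V.toEnvCpx.f p x) a
    change V.envCpx.d n n' (V.envMul h _ _) = V.envMul h₁ (V.envCpx.d _ _ _) _ +
      p.negOnePow • V.envMul h₂ _ (V.envCpx.d _ _ _) at e
    have e' : V.envCpx.d p (p - 1) (V.toEnvCpx.f p x) =
        V.toEnvCpx.f (p - 1) (V.cpx.d p (p - 1) x) := by
      rw [← ModuleCat.comp_apply, ← ModuleCat.comp_apply, V.toEnvCpx.comm]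
    have e'' : A.cpx.d p (p - 1) (f.f p x) = f.f (p - 1) (V.cpx.d p (p - 1) x) := by
      rw [← ModuleCat.comp_apply, ← ModuleCat.comp_apply, f.comm]
    rw [e, map_add, map_sign_smul, V.descLin_mul, V.descLin_mul, V.descLin_mul, ih hq, e',
      V.descLin_toEnvCpx, V.descLin_toEnvCpx, A.d_mul h _ _ hp hq, e'']
  | zero n => simp
  | add n a b ha hb => simp only [map_add, ha hn, hb hn]
  | smul n c a ha => simp only [map_smul, ha hn]

/-- The morphism of differential graded algebras out of the enveloping algebra
induced by a morphism of unital Lie algebras. -/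
def ULie.desc {K : Type u} [Field K] {V : ULie K} {A : DGA K} (f : V ⟶ (phiStar K).obj A) :
    V.env ⟶ A where
  hom :=
    { f := fun n => ModuleCat.ofHom (V.descLin A f.hom f.map_bracket f.map_unit n)
      comm' := by
        intro i j hij
        ext x
        exact (V.descLin_d A f.hom f.map_bracket f.map_unit hij x).symm }
  map_mul h x y := V.descLin_mul A f.hom f.map_bracket f.map_unit h x y
  map_one := V.descLin_one A f.hom f.map_bracket f.map_unit

/-- The universal property of the unital universal enveloping algebra. -/
def ULie.envEquiv {K : Type u} [Field K] (V : ULie K) (A : DGA K) :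
    (V.env ⟶ A) ≃ (V ⟶ (phiStar K).obj A) where
  toFun g := V.toEnv ≫ (phiStar K).map g
  invFun := ULie.desc
  left_inv g := by
    refine DGA.Hom.ext (HomologicalComplex.hom_ext _ _ fun n => ?_)
    ext a
    set f := V.toEnv ≫ (phiStar K).map g
    change V.descLin A f.hom f.map_bracket f.map_unit n a = g.hom.f n a
    induction n, a using V.env_induction with
    | one => exact (V.descLin_one ..).trans g.map_one.symm
    | gen_mul h x a ih =>
      refine (V.descLin_mul A f.hom f.map_bracket f.map_unit h _ _).trans ?_
      refine Eq.trans ?_ (g.map_mul h _ _).symm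
      rw [ih]
      exact congrArg (fun t => A.mul h t _)
        (V.descLin_toEnvCpx A f.hom f.map_bracket f.map_unit x)
    | zero n => exact (map_zero _).trans (map_zero _).symm
    | add n a b ha hb => 
      rw [map_add, ha, hb]
      exact (map_add (g.hom.f n).hom a b).symm
    | smul n c a ha =>
      rw [map_smul, ha]
      exact (map_smul (g.hom.f n).hom c a).symm
  right_inv f := by
    refine ULie.Hom.ext (HomologicalComplex.hom_ext _ _ fun n => ?_)
    ext x
    exact V.descLin_toEnvCpx A f.hom f.map_bracket f.map_unit x

/-- The unital universal enveloping algebra functor. -/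
def phiShriek (K : Type u) [Field K] : ULie K ⥤ DGA K :=
  Adjunction.leftAdjointOfEquiv (G := phiStar K) (fun V A => V.envEquiv A)
    (by intros; rfl)

/-- The unital universal enveloping algebra functor is left adjoint to the functor which takes
a differential graded algebra to the unital Lie algebra given by the graded commutator. -/
def phiAdjunction (K : Type u) [Field K] : phiShriek K ⊣ phiStar K :=
  Adjunction.adjunctionOfEquivLeft (G := phiStar K) (fun V A => V.envEquiv A)
    (by intros; rfl)

lemma phiShriek_map_gen {K : Type u} [Field K] {V W : ULie K} (f : V ⟶ W) {p : ℤ}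
    (x : V.cpx.X p) :
    ((phiShriek K).map f).hom.f p (V.toEnvCpx.f p x) = W.toEnvCpx.f p (f.hom.f p x) := by
  let g : V ⟶ (phiStar K).obj W.env := f ≫ W.envEquiv W.env (𝟙 W.env)
  exact V.descLin_toEnvCpx W.env g.hom g.map_bracket g.map_unit x

/-- The components of the map of enveloping algebras induced by a morphism `V ⟶ W`,
with values in the underlying algebra. -/
def ULie.mapVal {K : Type u} [Field K] {V W : ULie K} (f : V ⟶ W) (n : ℤ) :
    V.envCpx.X n →ₗ[K] W.Env :=
  (W.val n).comp (((phiShriek K).map f).hom.f n).hom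

lemma ULie.mapVal_gen_mul {K : Type u} [Field K] {V W : ULie K} (f : V ⟶ W) {p q n : ℤ}
    (h : p + q = n) (x : V.cpx.X p) (a : V.envCpx.X q) :
    ULie.mapVal f n (V.envMul h (V.toEnvCpx.f p x) a) =
      W.gen p (f.hom.f p x) * ULie.mapVal f q a := by
  refine (congrArg (W.val n) (((phiShriek K).map f).map_mul h (V.toEnvCpx.f p x) a)).trans ?_
  refine (W.val_envMul h _ _).trans ?_
  rw [phiShriek_map_gen]
  rfl

lemma ULie.mapVal_one {K : Type u} [Field K] {V W : ULie K} (f : V ⟶ W) :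
    ULie.mapVal f 0 (V.toCpx 1 V.one_mem_grade) = 1 :=
  congrArg (W.val 0) ((phiShriek K).map f).map_one

/-- An orthogonality relation on a category `C`, turning `C` into an orthogonal category: a
symmetric relation on pairs of morphisms with common target which is stable under pre- and
postcomposition. -/
structure Orthogonality (C : Type v) [Category.{w} C] where
  /-- the relation `f₁ ⊥ f₂` -/
  rel : ∀ {c₁ c₂ c : C}, (c₁ ⟶ c) → (c₂ ⟶ c) → Prop
  symm : ∀ {c₁ c₂ c : C} {f₁ : c₁ ⟶ c} {f₂ : c₂ ⟶ c}, rel f₁ f₂ → rel f₂ f₁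
  comp : ∀ {c₁ c₂ c b₁ b₂ d : C} {f₁ : c₁ ⟶ c} {f₂ : c₂ ⟶ c} (h₁ : b₁ ⟶ c₁) (h₂ : b₂ ⟶ c₂)
    (g : c ⟶ d), rel f₁ f₂ → rel (h₁ ≫ f₁ ≫ g) (h₂ ≫ f₂ ≫ g)

/-- A functor to unital Lie algebras is a linear field theory if the Lie bracket
`[B(f₁)(-), B(f₂)(-)] : B(c₁) ⊗ B(c₂) ⟶ B(c)` vanishes for all orthogonal pairs. -/
def IsLFT (K : Type u) [Field K] {C : Type v} [Category.{w} C] (O : Orthogonality C) :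
    ObjectProperty (C ⥤ ULie K) := fun B =>
  ∀ {c₁ c₂ c : C} (f₁ : c₁ ⟶ c) (f₂ : c₂ ⟶ c), O.rel f₁ f₂ →
    ∀ {p q n : ℤ} (h : p + q = n) (x : (B.obj c₁).cpx.X p) (y : (B.obj c₂).cpx.X q),
      (B.obj c).bracket h ((B.map f₁).hom.f p x) ((B.map f₂).hom.f q y) = 0

/-- The category of `Ch(K)`-valued linear field theories, a full subcategory of the category of
functors to unital Lie algebras. -/
abbrev LFT (K : Type u) [Field K] {C : Type v} [Category.{w} C] (O : Orthogonality C) :=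
  (IsLFT K O).FullSubcategory

/-- A functor to differential graded algebras is a quantum field theory if the graded commutator
`[A(f₁)(-), A(f₂)(-)] : A(c₁) ⊗ A(c₂) ⟶ A(c)` vanishes for all orthogonal pairs. -/
def IsQFT (K : Type u) [Field K] {C : Type v} [Category.{w} C] (O : Orthogonality C) :
    ObjectProperty (C ⥤ DGA K) := fun A =>
  ∀ {c₁ c₂ c : C} (f₁ : c₁ ⟶ c) (f₂ : c₂ ⟶ c), O.rel f₁ f₂ →
    ∀ {p q n : ℤ} (h : p + q = n) (x : (A.obj c₁).cpx.X p) (y : (A.obj c₂).cpx.X q),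
      (A.obj c).commutator h ((A.map f₁).hom.f p x) ((A.map f₂).hom.f q y) = 0

/-- The category of `Ch(K)`-valued quantum field theories, a full subcategory of the category of
functors to differential graded algebras. -/
abbrev QFT (K : Type u) [Field K] {C : Type v} [Category.{w} C] (O : Orthogonality C) :=
  (IsQFT K O).FullSubcategory

/-- The functor `QFT ⥤ LFT` which takes graded commutators objectwise. -/
def Ulin (K : Type u) [Field K] {C : Type v} [Category.{w} C] (O : Orthogonality C) :
    QFT K O ⥤ LFT K O :=
  (IsLFT K O).lift ((IsQFT K O).ι ⋙ (Functor.whiskeringRight C _ _).obj (phiStar K))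
    (fun A _ _ _ f₁ f₂ r _ _ _ h x y => A.property f₁ f₂ r h x y)

lemma sign_comm_one {V : Type*} [Ring V] (p : ℤ) (a : V) :
    1 * a = (0 * p).negOnePow • (a * 1) := by simp

lemma sign_comm_mul {R : Type*} [Ring R] {a a' b : R} {p p' n q : ℤ} (h : p + p' = n)
    (ha : a * b = (p * q).negOnePow • (b * a)) (ha' : a' * b = (p' * q).negOnePow • (b * a')) :
    (a * a') * b = (n * q).negOnePow • (b * (a * a')) := by
  rw [mul_assoc, ha', sign_mul_right, ← mul_assoc, ha, sign_mul_left, smul_smul, ← h, add_mul,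
    Int.negOnePow_add, mul_comm, mul_assoc]

lemma sign_comm_symm {R : Type*} [Ring R] {a b : R} {p q : ℤ}
    (h : a * b = (p * q).negOnePow • (b * a)) : b * a = (q * p).negOnePow • (a * b) := by
  rw [h, smul_smul, mul_comm q p, Int.units_mul_self, one_smul]

/-- If the brackets of the images of `f₁` and `f₂` vanish, then the graded commutators of the
images of the induced morphisms of enveloping algebras vanish. -/
lemma ULie.mapVal_commute {K : Type u} [Field K] {V₁ V₂ V : ULie K} (f₁ : V₁ ⟶ V) (f₂ : V₂ ⟶ V)
    (hf : ∀ {p q n : ℤ} (h : p + q = n) (x : V₁.cpx.X p) (y : V₂.cpx.X q),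
      V.bracket h (f₁.hom.f p x) (f₂.hom.f q y) = 0) {p q : ℤ} (a : V₁.envCpx.X p)
    (b : V₂.envCpx.X q) :
    ULie.mapVal f₁ p a * ULie.mapVal f₂ q b =
      (p * q).negOnePow • (ULie.mapVal f₂ q b * ULie.mapVal f₁ p a) := by
  have key : ∀ {p : ℤ} (x : V₁.cpx.X p) (q : ℤ) (b : V₂.envCpx.X q),
      V.gen p (f₁.hom.f p x) * ULie.mapVal f₂ q b =
      (p * q).negOnePow • (ULie.mapVal f₂ q b * V.gen p (f₁.hom.f p x)) := by
    intro p x q b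
    refine sign_comm_symm ?_
    induction q, b using V₂.env_induction with
    | one =>
      rw [ULie.mapVal_one]
      exact sign_comm_one _ _
    | @gen_mul q q' m h y b ih =>
      rw [ULie.mapVal_gen_mul]
      refine sign_comm_mul h (sign_comm_symm ?_) ih
      have := V.gen_bracket rfl (f₁.hom.f p x) (f₂.hom.f q y)
      rw [hf, map_zero] at this
      exact (sub_eq_zero.1 this.symm)
    | zero n => simp
    | add n a b ha hb => simp only [map_add, add_mul, mul_add, smul_add, ha, hb]
    | smul n c a ha => simp only [map_smul, smul_mul_assoc, mul_smul_comm, ha, smul_comm c]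
  induction p, a using V₁.env_induction with
  | one =>
    rw [ULie.mapVal_one]
    exact sign_comm_one _ _
  | @gen_mul p p' m h x a ih =>
    rw [ULie.mapVal_gen_mul]
    exact sign_comm_mul h (key x q b) ih
  | zero n => simp
  | add n a b ha hb => simp only [map_add, add_mul, mul_add, smul_add, ha, hb]
  | smul n c a ha => simp only [map_smul, smul_mul_assoc, mul_smul_comm, ha, smul_comm c]

lemma phiShriek_commutator {K : Type u} [Field K] {V₁ V₂ V : ULie K} (f₁ : V₁ ⟶ V) (f₂ : V₂ ⟶ V)
    (hf : ∀ {p q n : ℤ} (h : p + q = n) (x : V₁.cpx.X p) (y : V₂.cpx.X q),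
      V.bracket h (f₁.hom.f p x) (f₂.hom.f q y) = 0) {p q n : ℤ} (h : p + q = n)
    (a : ((phiShriek K).obj V₁).cpx.X p) (b : ((phiShriek K).obj V₂).cpx.X q) :
    ((phiShriek K).obj V).commutator h (((phiShriek K).map f₁).hom.f p a)
      (((phiShriek K).map f₂).hom.f q b) = 0 := by
  have h' : q + p = n := by omega
  refine V.val_injective n ?_
  refine (map_sub (V.val n) (V.envMul h (((phiShriek K).map f₁).hom.f p a)
    (((phiShriek K).map f₂).hom.f q b)) ((p * q).negOnePow •
      V.envMul h' (((phiShriek K).map f₂).hom.f q b) (((phiShriek K).map f₁).hom.f p a))).trans ?_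
  refine (sub_eq_zero.2 ?_).trans (map_zero (V.val n)).symm
  refine Eq.trans ?_ (map_sign_smul (V.val n) _ _).symm
  exact ULie.mapVal_commute f₁ f₂ hf a b

/-- The linear quantization functor `LFT ⥤ QFT`, which takes unital universal enveloping algebras
objectwise. It is the left adjoint of `Ulin`, see `qlinAdjunction`. -/
def Qlin (K : Type u) [Field K] {C : Type v} [Category.{w} C] (O : Orthogonality C) :
    LFT K O ⥤ QFT K O :=
  (IsQFT K O).lift ((IsLFT K O).ι ⋙ (Functor.whiskeringRight C _ _).obj (phiShriek K))
    (fun B _ _ _ f₁ f₂ r _ _ _ h x y =>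
      phiShriek_commutator (B.obj.map f₁) (B.obj.map f₂) (B.property f₁ f₂ r) h x y)

/-- Linear quantization is left adjoint to the functor which takes graded commutators. -/
def qlinAdjunction (K : Type u) [Field K] {C : Type v} [Category.{w} C] (O : Orthogonality C) :
    Qlin K O ⊣ Ulin K O :=
  ((phiAdjunction K).whiskerRight C).restrictFullyFaithful (IsLFT K O).fullyFaithfulι
    (IsQFT K O).fullyFaithfulι (Iso.refl _) (Iso.refl _)

/-- A linear field theory is homotopy `W`-constant if the chain map underlying `B(f)` is a
quasi-isomorphism for every morphism `f` in `W`. -/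
def LFT.HomotopyConstant {K : Type u} [Field K] {C : Type v} [Category.{w} C]
    {O : Orthogonality C} (W : MorphismProperty C) (B : LFT K O) : Prop :=
  ∀ ⦃c c' : C⦄ (f : c ⟶ c'), W f → QuasiIso ((ULie.forget K).map (B.obj.map f))

/-- A quantum field theory is homotopy `W`-constant if the chain map underlying `A(f)` is a
quasi-isomorphism for every morphism `f` in `W`. -/
def QFT.HomotopyConstant {K : Type u} [Field K] {C : Type v} [Category.{w} C]
    {O : Orthogonality C} (W : MorphismProperty C) (A : QFT K O) : Prop :=
  ∀ ⦃c c' : C⦄ (f : c ⟶ c'), W f → QuasiIso ((DGA.forget K).map (A.obj.map f))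

end LinearQuantization

end

/-!
Words in homogeneous letters span the enveloping algebra `U V`, and a linear map out of `U V` is
a multilinear function of words that ignores units and respects exchanges of adjacent letters. In
characteristic zero, symmetrization turns every multilinear function ignoring units into one that
also respects exchanges, by a projection natural enough to commute with the differential. This is
a form of the Poincaré-Birkhoff-Witt theorem, and it extends unit-preserving chain maps `V ⟶ W`,
which need not respect the brackets, and chain homotopies vanishing on the unit to the enveloping
algebras.

Over a field a quasi-isomorphism `f : V ⟶ W` has a homotopy inverse. If the unit is not a boundary,
it spans a direct summand, and the inverse and the homotopies can be chosen to respect the units;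
they induce a homotopy inverse of `U f`. If the unit is a boundary, `U V` and `U W` are both
contractible.
-/

noncomputable section

namespace LinearQuantization

/-! ### Averaging over the symmetric group -/

section Averaging

variable {K R : Type*} [Field K] [Ring R] [Algebra K R]

/-- The Coxeter word `s 0 * s 1 * ⋯ * s (k - 1)`, which represents a cycle of length `k + 1`. -/
def cyc (s : ℕ → R) : ℕ → R
  | 0 => 1
  | k + 1 => s 0 * cyc (fun i => s (i + 1)) k

variable (K) in
/-- The average over the symmetric group on `n` letters, where `s 0, …, s (n - 2)` represent the
adjacent transpositions. It is built from the coset decomposition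
`S (n + 1) = ⋃ k, S n * (0 1 ⋯ k)`, in which `S n` permutes the last `n` letters. -/
def avg (s : ℕ → R) : ℕ → R
  | 0 => 1
  | n + 1 => avg (fun i => s (i + 1)) n *
      ((n + 1 : K)⁻¹ • ∑ k ∈ Finset.range (n + 1), cyc s k)

/-- The elements `s 0, …, s (n - 2)` satisfy the Coxeter relations of the symmetric group on `n`
letters. -/
structure IsCoxeter (s : ℕ → R) (n : ℕ) : Prop where
  sq : ∀ i, i + 1 < n → s i * s i = 1
  comm : ∀ i j, i + 2 ≤ j → j + 1 < n → s i * s j = s j * s i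
  braid : ∀ i, i + 2 < n → s i * s (i + 1) * s i = s (i + 1) * s i * s (i + 1)

namespace IsCoxeter

variable {s : ℕ → R} {n : ℕ}

lemma shift (h : IsCoxeter s (n + 1)) : IsCoxeter (fun i => s (i + 1)) n where
  sq i hi := h.sq _ (by omega)
  comm i j hij hj := h.comm _ _ (by omega) (by omega)
  braid i hi := h.braid _ (by omega)

lemma op (h : IsCoxeter s n) : IsCoxeter (fun i => MulOpposite.op (s i)) n where
  sq i hi := by rw [← MulOpposite.op_mul, h.sq i hi, MulOpposite.op_one]
  comm i j hij hj := by rw [← MulOpposite.op_mul, ← MulOpposite.op_mul, h.comm i j hij hj]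
  braid i hi := by simp only [← MulOpposite.op_mul, ← mul_assoc, h.braid i hi]

end IsCoxeter

lemma cyc_succ (s : ℕ → R) (k : ℕ) : cyc s (k + 1) = cyc s k * s k := by
  induction k generalizing s with
  | zero => simp [cyc]
  | succ k ih => rw [cyc, ih, cyc, mul_assoc]

namespace IsCoxeter

variable {s : ℕ → R} {n : ℕ}

lemma cyc_mul_of_lt (h : IsCoxeter s n) {k i : ℕ} (hk : k < i) (hi : i + 1 < n) :
    cyc s k * s i = s i * cyc s k := by
  induction k with
  | zero => simp [cyc]
  | succ k ih =>
    rw [cyc_succ, mul_assoc, h.comm k i (by omega) hi, ← mul_assoc, ih (by omega), mul_assoc]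

lemma cyc_mul_of_gt (h : IsCoxeter s n) {k i : ℕ} (hi : i + 1 < k) (hk : k < n) :
    cyc s k * s i = s (i + 1) * cyc s k := by
  induction k with
  | zero => omega
  | succ k ih =>
    obtain rfl | hk' : k = i + 1 ∨ i + 1 < k := by omega
    · rw [cyc_succ, cyc_succ, mul_assoc, mul_assoc, ← mul_assoc (s i), h.braid i (by omega),
        ← mul_assoc, ← mul_assoc, h.cyc_mul_of_lt (by omega) (by omega)]
      simp only [mul_assoc]
    · rw [cyc_succ, mul_assoc, ← h.comm i k (by omega) (by omega), ← mul_assoc,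
        ih hk' (by omega), mul_assoc]

/-- Right multiplication by `s i` permutes the cosets in the definition of the average. -/
lemma avg_mul (h : IsCoxeter s n) {i : ℕ} (hi : i + 1 < n) : avg K s n * s i = avg K s n := by
  induction n generalizing s i with
  | zero => omega
  | succ n ih =>
    rw [avg, mul_assoc, smul_mul_assoc, mul_smul_comm, mul_smul_comm, Finset.sum_mul,
      Finset.mul_sum, Finset.mul_sum]
    congr 1
    refine Finset.sum_equiv (Equiv.swap i (i + 1)) (fun k => ?_) (fun k hk => ?_)
    · rw [Equiv.swap_apply_def]
      split_ifs <;> simp only [Finset.mem_range] <;> omega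
    · rw [Finset.mem_range] at hk
      obtain rfl | rfl | hlt | hgt : k = i ∨ k = i + 1 ∨ k < i ∨ i + 1 < k := by omega
      · rw [Equiv.swap_apply_left, cyc_succ]
      · rw [Equiv.swap_apply_right, cyc_succ, mul_assoc, h.sq i (by omega), mul_one]
      · rw [Equiv.swap_apply_of_ne_of_ne (by omega) (by omega), h.cyc_mul_of_lt hlt hi,
          ← mul_assoc]
        obtain ⟨j, rfl⟩ : ∃ j, i = j + 1 := ⟨i - 1, by omega⟩
        rw [ih h.shift (by omega)]
      · rw [Equiv.swap_apply_of_ne_of_ne (by omega) (by omega), h.cyc_mul_of_gt hgt hk,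
          ← mul_assoc, ih h.shift (by omega)]

end IsCoxeter

section Module

variable {M : Type*} [AddCommGroup M] [Module K M] [Module R M] [IsScalarTower K R M]
  {s : ℕ → R} {n : ℕ} {m : M}

lemma cyc_smul_of_fixed (hm : ∀ i, i < n → s i • m = m) : cyc s n • m = m := by
  induction n with
  | zero => exact one_smul R m
  | succ n ih =>
    rw [cyc_succ, mul_smul, hm n (Nat.lt_succ_self n), ih fun i hi => hm i (Nat.lt_succ_of_lt hi)]

lemma avg_smul_of_fixed [CharZero K] (hm : ∀ i, i + 1 < n → s i • m = m) :
    avg K s n • m = m := by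
  induction n generalizing s with
  | zero => exact one_smul R m
  | succ n ih =>
    have hcyc : ∀ k ∈ Finset.range (n + 1), cyc s k • m = m := fun k hk =>
      cyc_smul_of_fixed fun i hi => hm i (by have := Finset.mem_range.1 hk; omega)
    rw [avg, mul_smul, smul_assoc, Finset.sum_smul, Finset.sum_congr rfl hcyc, Finset.sum_const,
      Finset.card_range, ← Nat.cast_smul_eq_nsmul K, smul_smul, Nat.cast_succ,
      inv_mul_cancel₀ (Nat.cast_add_one_ne_zero n), one_smul,
      ih fun i hi => hm (i + 1) (Nat.succ_lt_succ hi)]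

end Module

/-- The element `t` obtained by averaging in the opposite ring is fixed by left multiplication
with each `s i`, and it agrees with the average: `t = avg * t = avg`. -/
lemma IsCoxeter.mul_avg [CharZero K] {s : ℕ → R} {n : ℕ} (h : IsCoxeter s n) {i : ℕ}
    (hi : i + 1 < n) : s i * avg K s n = avg K s n := by
  set t := MulOpposite.unop (avg K (fun i => MulOpposite.op (s i)) n) with ht
  have hst : ∀ i, i + 1 < n → s i * t = t := fun i hi =>
    MulOpposite.op_injective (h.op.avg_mul (K := K) hi)
  have avg_mul_t : avg K s n * t = t := by
    rw [← smul_eq_mul, avg_smul_of_fixed hst]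
  have avg_mul_t' : avg K s n * t = avg K s n := by
    refine MulOpposite.op_injective ?_
    rw [MulOpposite.op_mul, ht, MulOpposite.op_unop, ← smul_eq_mul, avg_smul_of_fixed]
    intro i hi
    rw [smul_eq_mul, ← MulOpposite.op_mul, h.avg_mul hi]
  rw [← avg_mul_t', avg_mul_t, hst i hi]

end Averaging

section AveragingRelation

variable {K X Y : Type*} [Field K] [AddCommGroup X] [Module K X] [AddCommGroup Y] [Module K Y]
  {s : ℕ → Module.End K X} {s' : ℕ → Module.End K Y} {P : Submodule K (X × Y)} {n : ℕ}

lemma cyc_rel (h : ∀ i < n, ∀ z ∈ P, (s i z.1, s' i z.2) ∈ P) :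
    ∀ z ∈ P, (cyc s n z.1, cyc s' n z.2) ∈ P := by
  induction n with
  | zero => exact fun z hz => hz
  | succ n ih =>
    intro z hz
    rw [cyc_succ, cyc_succ]
    exact ih (fun i hi => h i (Nat.lt_succ_of_lt hi)) _ (h n (Nat.lt_succ_self n) z hz)

lemma avg_rel (h : ∀ i, i + 1 < n → ∀ z ∈ P, (s i z.1, s' i z.2) ∈ P) :
    ∀ z ∈ P, (avg K s n z.1, avg K s' n z.2) ∈ P := by
  induction n generalizing s s' with
  | zero => exact fun z hz => hz
  | succ n ih =>
    intro z hz
    refine ih (s := fun i => s (i + 1)) (s' := fun i => s' (i + 1))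
      (fun i hi => h (i + 1) (Nat.succ_lt_succ hi)) (_, _) ?_
    simp only [LinearMap.smul_apply, LinearMap.sum_apply]
    rw [← Prod.smul_mk, prod_mk_sum]
    exact P.smul_mem _ (P.sum_mem fun k hk =>
      cyc_rel (fun i hi => h i (by have := Finset.mem_range.1 hk; omega)) z hz)

lemma avg_mem {N : Submodule K X} (h : ∀ i, i + 1 < n → ∀ x ∈ N, s i x ∈ N) :
    ∀ x ∈ N, avg K s n x ∈ N := fun x hx =>
  (avg_rel (s' := s) (P := N.prod ⊤) (fun i hi _ hz => ⟨h i hi _ hz.1, trivial⟩) (x, x)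
    ⟨hx, trivial⟩).1

lemma map_avg {J : X →ₗ[K] Y} (h : ∀ i, i + 1 < n → ∀ x, J (s i x) = s' i (J x)) (x : X) :
    J (avg K s n x) = avg K s' n (J x) :=
  (avg_rel (P := J.graph) (fun i hi z hz => (congrArg (s' i) hz).trans (h i hi z.1).symm) (x, J x)
    rfl).symm

end AveragingRelation

/-! ### Functions on words -/

section Words

variable {K : Type u} [Field K] {E : Ch K} {A : Type*} [AddCommGroup A] [Module K A]

/-- A homogeneous element of a chain complex together with its degree. -/
abbrev Letter (E : Ch K) : Type u := Σ p : ℤ, E.X p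

/-- The Koszul sign of the exchange of two homogeneous elements. -/
def koszul (x y : Letter E) : ℤˣ := (x.1 * y.1).negOnePow

lemma koszul_comm (x y : Letter E) : koszul x y = koszul y x := by
  rw [koszul, koszul, mul_comm]

lemma koszul_mul_self (x y : Letter E) : koszul x y * koszul x y = 1 := Int.units_mul_self _

/-- The total degree of a word. -/
def wordDeg (w : List (Letter E)) : ℤ := (w.map Sigma.fst).sum

lemma wordDeg_cons (x : Letter E) (w : List (Letter E)) : wordDeg (x :: w) = x.1 + wordDeg w :=
  List.sum_cons

lemma exists_eq_append_cons_cons {α : Type*} {i : ℕ} {l : List α} (h : i + 1 < l.length) :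
    ∃ a x y b, l = a ++ x :: y :: b ∧ a.length = i := by
  refine ⟨l.take i, l[i], l[i + 1], l.drop (i + 2), ?_, by simp; omega⟩
  rw [List.cons_getElem_drop_succ, List.cons_getElem_drop_succ, List.take_append_drop]

/-- A function on words is multilinear if it is linear in each letter. -/
def IsMultilinear (φ : List (Letter E) → A) : Prop :=
  ∀ a b p, IsLinearMap K fun x : E.X p => φ (a ++ ⟨p, x⟩ :: b)

namespace IsMultilinear

variable {φ ψ : List (Letter E) → A}

lemma of_cons (hhead : ∀ p l, IsLinearMap K fun x : E.X p => φ (⟨p, x⟩ :: l))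
    (htail : ∀ x, IsMultilinear fun l => φ (x :: l)) : IsMultilinear φ
  | [], b, p => hhead p b
  | x :: a, b, p => htail x a b p

lemma head (hφ : IsMultilinear φ) (p : ℤ) :
    IsLinearMap K fun (x : E.X p) (l : List (Letter E)) => φ (⟨p, x⟩ :: l) where
  map_add x y := funext fun l => (hφ [] l p).map_add x y
  map_smul c x := funext fun l => (hφ [] l p).map_smul c x

lemma tail (hφ : IsMultilinear φ) (x : Letter E) : IsMultilinear fun l => φ (x :: l) :=
  fun a => hφ (x :: a)

variable (E A) in
/-- The submodule of multilinear functions on words. -/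
def submodule : Submodule K (List (Letter E) → A) where
  carrier := {φ | IsMultilinear φ}
  zero_mem' _ _ _ := (0 : _ →ₗ[K] A).isLinear
  add_mem' hφ hψ a b p := ((hφ a b p).mk' _ + (hψ a b p).mk' _).isLinear
  smul_mem' c _ hφ a b p := (c • (hφ a b p).mk' _).isLinear

lemma add (hφ : IsMultilinear φ) (hψ : IsMultilinear ψ) : IsMultilinear (φ + ψ) :=
  (submodule E A).add_mem hφ hψ

lemma sign_smul (e : ℤˣ) (hφ : IsMultilinear φ) : IsMultilinear (e • φ) :=
  (submodule E A).smul_of_tower_mem e hφ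

end IsMultilinear

end Words

section Exchange

variable {K : Type u} [Field K] (V : ULie K) {A : Type*} [AddCommGroup A]

namespace ULie

/-- The bracket of two homogeneous elements. -/
def br (x y : Letter V.cpx) : Letter V.cpx := ⟨x.1 + y.1, V.bracket rfl x.2 y.2⟩

lemma br_mk {p q n : ℤ} (h : p + q = n) (x : V.cpx.X p) (y : V.cpx.X q) :
    V.br ⟨p, x⟩ ⟨q, y⟩ = ⟨n, V.bracket h x y⟩ := by
  subst h; rfl

/-- `V.exch φ i w` is the value `φ w` predicted, from the values of `φ` on other words, by the
relation `x y = (-1)^(|x||y|) y x + [x, y]` for the letters at positions `i` and `i + 1`. -/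
def exch (φ : List (Letter V.cpx) → A) : ℕ → List (Letter V.cpx) → A
  | 0, x :: y :: l => koszul x y • φ (y :: x :: l) + φ (V.br x y :: l)
  | i + 1, x :: l => exch (fun l => φ (x :: l)) i l
  | _, l => φ l

variable {V} {φ : List (Letter V.cpx) → A}

lemma exch_append (a : List (Letter V.cpx)) (k : ℕ) (l : List (Letter V.cpx)) :
    V.exch φ (a.length + k) (a ++ l) = V.exch (fun l => φ (a ++ l)) k l := by
  induction a generalizing φ with
  | nil => simp
  | cons x a ih => rw [List.length_cons, Nat.add_right_comm]; exact ih

lemma exch_length_append (a : List (Letter V.cpx)) (x y : Letter V.cpx)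
    (b : List (Letter V.cpx)) : V.exch φ a.length (a ++ x :: y :: b) =
      koszul x y • φ (a ++ y :: x :: b) + φ (a ++ V.br x y :: b) :=
  exch_append a 0 (x :: y :: b)

variable [Module K A]

variable (V A) in
lemma isLinearMap_exch (i : ℕ) :
    IsLinearMap K fun φ : List (Letter V.cpx) → A => V.exch φ i := by
  constructor
  · intro φ ψ
    funext w
    induction i generalizing φ ψ w with
    | zero =>
      match w with
      | [] | [_] => rfl
      | x :: y :: l => simp only [exch, Pi.add_apply, smul_add]; abel
    | succ i ih =>
      match w with
      | [] => rfl
      | x :: l => exact ih _ _ l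
  · intro c φ
    funext w
    induction i generalizing φ w with
    | zero =>
      match w with
      | [] | [_] => rfl
      | x :: y :: l => simp only [exch, Pi.smul_apply, smul_add, smul_comm c]
    | succ i ih =>
      match w with
      | [] => rfl
      | x :: l => exact ih _ l

end ULie

lemma IsMultilinear.exch [Module K A] {V : ULie K} {φ : List (Letter V.cpx) → A}
    (hφ : IsMultilinear φ) (i : ℕ) : IsMultilinear (V.exch φ i) := by
  induction i generalizing φ with
  | zero =>
    refine .of_cons (fun p l => ?_) fun x => .of_cons (fun q l => ?_) fun y => ?_
    · match l with
      | [] => exact hφ [] [] p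
      | y :: l =>
        exact ((p * y.1).negOnePow • (hφ [y] l p).mk' _ +
          (hφ [] l (p + y.1)).mk' _ ∘ₗ (V.bracket rfl).flip y.2).isLinear
    · exact ((x.1 * q).negOnePow • (hφ [] (x :: l) q).mk' _ +
        (hφ [] l (x.1 + q)).mk' _ ∘ₗ V.bracket rfl x.2).isLinear
    · exact (((hφ.tail y).tail x).sign_smul _).add (hφ.tail (V.br x y))
  | succ i ih =>
    refine .of_cons (fun p l => ?_) fun x => ih (hφ.tail x)
    exact (LinearMap.proj l ∘ₗ (V.isLinearMap_exch A i).mk' _ ∘ₗ (hφ.head p).mk' _).isLinear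

end Exchange

section ExchangeOperators

variable {K : Type u} [Field K] (V : ULie K) (A : Type*) [AddCommGroup A] [Module K A]

namespace ULie

/-- The operator which exchanges the letters at positions `i` and `i + 1` in the words of length `n`
and does nothing to the other words. -/
def exchOp (n i : ℕ) : Module.End K (List (Letter V.cpx) → A) where
  toFun φ w := if w.length = n then V.exch φ i w else φ w
  map_add' φ ψ := by
    funext w
    simp only [(V.isLinearMap_exch A i).map_add, Pi.add_apply]
    split_ifs <;> rfl
  map_smul' c φ := by
    funext w
    simp only [(V.isLinearMap_exch A i).map_smul, Pi.smul_apply, RingHom.id_apply]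
    split_ifs <;> rfl

/-- The multilinear functions on words which satisfy the relation `x y = (-1)^(|x||y|) y x + [x, y]`
on all words of length less than `n`. -/
def stage (n : ℕ) : Submodule K (List (Letter V.cpx) → A) where
  carrier := {φ | IsMultilinear φ ∧ ∀ a x y b, (a ++ x :: y :: b).length < n →
    φ (a ++ x :: y :: b) = koszul x y • φ (a ++ y :: x :: b) + φ (a ++ V.br x y :: b)}
  zero_mem' := ⟨(IsMultilinear.submodule V.cpx A).zero_mem, by simp⟩
  add_mem' {φ ψ} hφ hψ := ⟨hφ.1.add hψ.1, fun a x y b hn => by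
    rw [Pi.add_apply, Pi.add_apply, Pi.add_apply, hφ.2 a x y b hn, hψ.2 a x y b hn, smul_add]
    abel⟩
  smul_mem' c φ hφ := ⟨(IsMultilinear.submodule V.cpx A).smul_mem c hφ.1, fun a x y b hn => by
    rw [Pi.smul_apply, Pi.smul_apply, Pi.smul_apply, hφ.2 a x y b hn, smul_add, smul_comm c]⟩

variable {V A} {n i : ℕ} {φ : List (Letter V.cpx) → A}

lemma exchOp_apply_of_length_eq {w : List (Letter V.cpx)} (hw : w.length = n) :
    V.exchOp A n i φ w = V.exch φ i w := if_pos hw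

lemma exchOp_apply_of_length_ne {w : List (Letter V.cpx)} (hw : w.length ≠ n) :
    V.exchOp A n i φ w = φ w := if_neg hw

lemma exchOp_append_cons_cons {a b : List (Letter V.cpx)} {x y : Letter V.cpx}
    (ha : a.length = i) (hn : (a ++ x :: y :: b).length = n) :
    V.exchOp A n i φ (a ++ x :: y :: b) =
      koszul x y • φ (a ++ y :: x :: b) + φ (a ++ V.br x y :: b) := by
  rw [exchOp_apply_of_length_eq hn, ← ha, exch_length_append]

end ULie

lemma IsMultilinear.exchOp {V : ULie K} {A : Type*} [AddCommGroup A] [Module K A]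
    {φ : List (Letter V.cpx) → A} (hφ : IsMultilinear φ) (n i : ℕ) :
    IsMultilinear (V.exchOp A n i φ) := by
  intro a b p
  by_cases hn : a.length + (b.length + 1) = n
  · have hop : ∀ x : V.cpx.X p, V.exchOp A n i φ (a ++ ⟨p, x⟩ :: b) =
        V.exch φ i (a ++ ⟨p, x⟩ :: b) := fun x =>
      ULie.exchOp_apply_of_length_eq (by simpa using hn)
    simpa only [hop] using hφ.exch i a b p
  · have hop : ∀ x : V.cpx.X p, V.exchOp A n i φ (a ++ ⟨p, x⟩ :: b) = φ (a ++ ⟨p, x⟩ :: b) :=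
      fun x => ULie.exchOp_apply_of_length_ne (by simpa using hn)
    simpa only [hop] using hφ a b p

lemma exists_eq_append_cons_cons_append_cons_cons {α : Type*} {i j : ℕ} {l : List α}
    (hij : i + 2 ≤ j) (hj : j + 1 < l.length) : ∃ a x y b z t c,
      l = a ++ x :: y :: (b ++ z :: t :: c) ∧ a.length = i ∧ a.length + (b.length + 2) = j := by
  obtain ⟨a, x, y, l, rfl, rfl⟩ := exists_eq_append_cons_cons (i := i) (l := l) (by omega)
  obtain ⟨b, z, t, c, rfl, hb⟩ := exists_eq_append_cons_cons (i := j - (a.length + 2)) (l := l)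
    (by simp only [List.length_append, List.length_cons] at hj; omega)
  exact ⟨a, x, y, b, z, t, c, rfl, rfl, by omega⟩

lemma exists_eq_append_cons_cons_cons {α : Type*} {i : ℕ} {l : List α} (h : i + 2 < l.length) :
    ∃ a x y z b, l = a ++ x :: y :: z :: b ∧ a.length = i := by
  obtain ⟨a, x, y, l, rfl, rfl⟩ := exists_eq_append_cons_cons (i := i) (l := l) (by omega)
  obtain ⟨z, b, rfl⟩ := List.exists_cons_of_length_pos (l := l)
    (by simp only [List.length_append, List.length_cons] at h; omega)
  exact ⟨a, x, y, z, b, rfl, rfl⟩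

section Bracket

variable {V A}

lemma ULie.bracket_leibniz {p q r pq qr pr n : ℤ} (hpq : p + q = pq) (hqr : q + r = qr)
    (hpr : p + r = pr) (h₁ : p + qr = n) (h₂ : q + pr = n) (h₃ : pq + r = n)
    (x : V.cpx.X p) (y : V.cpx.X q) (z : V.cpx.X r) :
    V.bracket h₃ (V.bracket hpq x y) z + (p * q).negOnePow • V.bracket h₂ y (V.bracket hpr x z) =
      V.bracket h₁ x (V.bracket hqr y z) := by
  subst hpq
  have hrp : r + p = pr := by omega
  have h₃' : r + (p + q) = n := by omega
  have h := V.jacobi rfl hqr hrp h₁ h₂ h₃' x y z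
  have hsign : (p * (q + r) + r * p).negOnePow = (p * q).negOnePow := by
    rw [show p * (q + r) + r * p = p * q + 2 * (p * r) by ring, Int.negOnePow_add,
      Int.negOnePow_even (2 * (p * r)) (even_two_mul _), mul_one]
  rw [V.bracket_antisymm h₃' h₃, V.bracket_antisymm hrp hpr, map_neg, map_sign_smul, smul_neg,
    smul_neg, smul_smul, smul_smul, Int.units_mul_self, one_smul, ← Int.negOnePow_add, hsign,
    ← sub_eq_add_neg, ← sub_eq_add_neg, sub_eq_zero, sub_eq_iff_eq_add] at h
  rw [h, add_comm]

lemma koszul_br_left (x y z : Letter V.cpx) : koszul (V.br x y) z = koszul x z * koszul y z := by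
  simp only [koszul, ULie.br, add_mul, Int.negOnePow_add]

lemma koszul_br_right (x y z : Letter V.cpx) : koszul x (V.br y z) = koszul x y * koszul x z := by
  simp only [koszul, ULie.br, mul_add, Int.negOnePow_add]

namespace IsMultilinear

variable {φ : List (Letter V.cpx) → A}

lemma br_antisymm (hφ : IsMultilinear φ) (a b : List (Letter V.cpx)) (x y : Letter V.cpx) :
    koszul x y • φ (a ++ V.br y x :: b) + φ (a ++ V.br x y :: b) = 0 := by
  obtain ⟨p, x⟩ := x
  obtain ⟨q, y⟩ := y
  have hqp : q + p = p + q := add_comm q p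
  rw [V.br_mk rfl x y, V.br_mk hqp, V.bracket_antisymm rfl hqp, (hφ a b (p + q)).map_neg,
    add_neg_eq_zero]
  exact (map_sign_smul ((hφ a b (p + q)).mk' _) _ _).symm

lemma br_leibniz (hφ : IsMultilinear φ) (a b : List (Letter V.cpx)) (x y z : Letter V.cpx) :
    φ (a ++ V.br (V.br x y) z :: b) + koszul x y • φ (a ++ V.br y (V.br x z) :: b) =
      φ (a ++ V.br x (V.br y z) :: b) := by
  obtain ⟨p, x⟩ := x
  obtain ⟨q, y⟩ := y
  obtain ⟨r, z⟩ := z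
  have h₂ : q + (p + r) = p + (q + r) := by ring
  have h₃ : (p + q) + r = p + (q + r) := by ring
  rw [V.br_mk rfl x y, V.br_mk rfl x z, V.br_mk rfl y z, V.br_mk h₃, V.br_mk h₂, V.br_mk rfl x,
    ← V.bracket_leibniz rfl rfl rfl rfl h₂ h₃, (hφ a b _).map_add]
  congr 1
  exact (map_sign_smul ((hφ a b (p + (q + r))).mk' _) _ _).symm

end IsMultilinear

end Bracket

namespace ULie

variable {V A} {n i j : ℕ} {φ : List (Letter V.cpx) → A}

lemma exchOp_mem_stage (hφ : φ ∈ V.stage A n) (i : ℕ) : V.exchOp A n i φ ∈ V.stage A n := by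
  refine ⟨hφ.1.exchOp n i, fun a x y b hn => ?_⟩
  have hyx : (a ++ y :: x :: b).length < n := by simpa using hn
  have hbr : (a ++ V.br x y :: b).length < n := by simp at hn ⊢; omega
  rw [exchOp_apply_of_length_ne hn.ne, exchOp_apply_of_length_ne hyx.ne,
    exchOp_apply_of_length_ne hbr.ne, hφ.2 a x y b hn]

lemma exchOp_append_br {a b : List (Letter V.cpx)} {x y : Letter V.cpx}
    (hn : (a ++ x :: y :: b).length = n) :
    V.exchOp A n i φ (a ++ V.br x y :: b) = φ (a ++ V.br x y :: b) :=
  exchOp_apply_of_length_ne (by simp at hn ⊢; omega)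

lemma exchOp_exchOp_self (hφ : IsMultilinear φ) (hi : i + 1 < n) :
    V.exchOp A n i (V.exchOp A n i φ) = φ := by
  funext w
  by_cases hw : w.length = n
  · obtain ⟨a, x, y, b, rfl, ha⟩ := exists_eq_append_cons_cons (hw ▸ hi)
    rw [exchOp_append_cons_cons ha hw, exchOp_append_cons_cons ha (by simpa using hw),
      exchOp_append_br hw, smul_add, smul_smul, koszul_comm y x, koszul_mul_self, one_smul,
      add_assoc, hφ.br_antisymm, add_zero]
  · rw [exchOp_apply_of_length_ne hw, exchOp_apply_of_length_ne hw]

/-- Both sides only differ in the terms with one bracket, which are related by the exchange relation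
on words of length `n - 1`. -/
lemma exchOp_comm (hφ : φ ∈ V.stage A n) (hij : i + 2 ≤ j) (hj : j + 1 < n) :
    V.exchOp A n i (V.exchOp A n j φ) = V.exchOp A n j (V.exchOp A n i φ) := by
  funext w
  by_cases hw : w.length = n
  · obtain ⟨a, x, y, b, z, t, c, rfl, ha, hb⟩ :=
      exists_eq_append_cons_cons_append_cons_cons hij (hw ▸ hj)
    have hlen : a.length + (b.length + (c.length + 4)) = n := by simp at hw; omega
    have exch_i (ψ : List (Letter V.cpx) → A) (x y z t : Letter V.cpx) :
        V.exchOp A n i ψ (a ++ x :: y :: (b ++ z :: t :: c)) =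
          koszul x y • ψ (a ++ y :: x :: (b ++ z :: t :: c)) +
            ψ (a ++ V.br x y :: (b ++ z :: t :: c)) :=
      exchOp_append_cons_cons ha (by simp; omega)
    have exch_j (ψ : List (Letter V.cpx) → A) (x y z t : Letter V.cpx) :
        V.exchOp A n j ψ (a ++ x :: y :: (b ++ z :: t :: c)) =
          koszul z t • ψ (a ++ x :: y :: (b ++ t :: z :: c)) +
            ψ (a ++ x :: y :: (b ++ V.br z t :: c)) := by
      simpa using
        exchOp_append_cons_cons (V := V) (φ := ψ) (a := a ++ x :: y :: b) (x := z) (y := t)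
        (b := c) (by simp; omega) (by simp; omega)
    have short_i := hφ.2 a x y (b ++ V.br z t :: c) (by simp; omega)
    have short_j : φ (a ++ V.br x y :: (b ++ z :: t :: c)) =
        koszul z t • φ (a ++ V.br x y :: (b ++ t :: z :: c)) +
          φ (a ++ V.br x y :: (b ++ V.br z t :: c)) := by
      simpa using hφ.2 (a ++ V.br x y :: b) z t c (by simp; omega)
    rw [exch_i, exch_j, exch_j, exch_i, exchOp_apply_of_length_ne (by simp; omega),
      exchOp_apply_of_length_ne (by simp; omega), short_i, short_j]
    simp only [smul_add, smul_smul, mul_comm (koszul z t)]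
    abel
  · simp only [exchOp_apply_of_length_ne hw]

/-- Expanding both sides down to `φ (z y x)`, the terms with one bracket are compared by the
exchange relation on words of length `n - 1` and the remaining terms by the Jacobi identity. -/
lemma exchOp_braid (hφ : φ ∈ V.stage A n) (hi : i + 2 < n) :
    V.exchOp A n i (V.exchOp A n (i + 1) (V.exchOp A n i φ)) =
      V.exchOp A n (i + 1) (V.exchOp A n i (V.exchOp A n (i + 1) φ)) := by
  funext w
  by_cases hw : w.length = n
  · obtain ⟨a, x, y, z, b, rfl, ha⟩ := exists_eq_append_cons_cons_cons (hw ▸ hi)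
    have hlen : a.length + (b.length + 3) = n := by simpa [add_assoc] using hw
    have exch_left (ψ : List (Letter V.cpx) → A) (x y z : Letter V.cpx) :
        V.exchOp A n i ψ (a ++ x :: y :: z :: b) =
          koszul x y • ψ (a ++ y :: x :: z :: b) + ψ (a ++ V.br x y :: z :: b) :=
      exchOp_append_cons_cons ha (by simp; omega)
    have exch_right (ψ : List (Letter V.cpx) → A) (x y z : Letter V.cpx) :
        V.exchOp A n (i + 1) ψ (a ++ x :: y :: z :: b) =
          koszul y z • ψ (a ++ x :: z :: y :: b) + ψ (a ++ x :: V.br y z :: b) := by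
      simpa using exchOp_append_cons_cons (V := V) (φ := ψ) (a := a ++ [x]) (x := y) (y := z)
        (b := b) (by simp; omega) (by simp; omega)
    have short (x y : Letter V.cpx) (k : ℕ) (ψ : List (Letter V.cpx) → A) :
        V.exchOp A n k ψ (a ++ x :: y :: b) = ψ (a ++ x :: y :: b) :=
      exchOp_apply_of_length_ne (by simp; omega)
    have short_exch (x y : Letter V.cpx) := hφ.2 a x y b (by simp; omega)
    rw [exch_left, exch_right, exch_left, exch_right, exch_left, exch_right]
    simp only [short]
    rw [short_exch (V.br x y) z, short_exch x (V.br y z), short_exch y (V.br x z),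
      ← hφ.1.br_leibniz a b x y z]
    simp only [koszul_br_left, koszul_br_right, smul_add, smul_smul]
    rw [koszul_comm y x, ← mul_assoc (koszul x y) (koszul x y), koszul_mul_self, one_mul,
      mul_left_comm (koszul x y) (koszul x z), mul_comm (koszul y z) (koszul x z),
      mul_left_comm (koszul y z) (koszul x z), mul_comm (koszul x y) (koszul y z)]
    abel
  · simp only [exchOp_apply_of_length_ne hw]

variable (V A n) in
lemma isCoxeter_exchOp :
    IsCoxeter (fun i => (V.exchOp A n i).restrict fun _ hφ => exchOp_mem_stage hφ i) n where
  sq _ hi := LinearMap.ext fun φ => Subtype.ext (exchOp_exchOp_self φ.2.1 hi)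
  comm _ _ hij hj := LinearMap.ext fun φ => Subtype.ext (exchOp_comm φ.2 hij hj)
  braid _ hi := LinearMap.ext fun φ => Subtype.ext (exchOp_braid φ.2 hi)

end ULie
end ExchangeOperators

section Symmetrization

variable {K : Type u} [Field K] (V : ULie K) (A : Type*) [AddCommGroup A] [Module K A]

namespace ULie

/-- The multilinear functions on words which do not change if a letter `1` is deleted. -/
def unitalFun : Submodule K (List (Letter V.cpx) → A) where
  carrier := {φ | IsMultilinear φ ∧ ∀ a b, φ (a ++ ⟨0, V.unit⟩ :: b) = φ (a ++ b)}
  zero_mem' := ⟨(IsMultilinear.submodule V.cpx A).zero_mem, fun _ _ => rfl⟩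
  add_mem' hφ hψ := ⟨hφ.1.add hψ.1, fun a b => congrArg₂ (· + ·) (hφ.2 a b) (hψ.2 a b)⟩
  smul_mem' c _ hφ :=
    ⟨(IsMultilinear.submodule V.cpx A).smul_mem c hφ.1, fun a b => congrArg (c • ·) (hφ.2 a b)⟩

/-- The functions on words which descend to linear maps on the enveloping algebra. -/
def envFun : Submodule K (List (Letter V.cpx) → A) := V.unitalFun A ⊓ ⨅ n, V.stage A n

/-- The operator which symmetrizes the words of length `1, …, n` in this order. -/
def pbwOp : ℕ → Module.End K (List (Letter V.cpx) → A)
  | 0 => 1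
  | n + 1 => avg K (V.exchOp A (n + 1)) (n + 1) * pbwOp n

/-- The projection of the unital multilinear functions onto those which descend to the enveloping
algebra, see `pbw_mem_envFun` and `pbw_of_mem_envFun`. This is a functional form of the
Poincaré-Birkhoff-Witt theorem in characteristic zero. -/
def pbw : Module.End K (List (Letter V.cpx) → A) :=
  LinearMap.pi fun w => LinearMap.proj w ∘ₗ V.pbwOp A w.length

variable {V A} {n i : ℕ} {φ ψ : List (Letter V.cpx) → A}

lemma mem_envFun : φ ∈ V.envFun A ↔ φ ∈ V.unitalFun A ∧ ∀ a x y b,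
    φ (a ++ x :: y :: b) = koszul x y • φ (a ++ y :: x :: b) + φ (a ++ V.br x y :: b) := by
  rw [envFun, Submodule.mem_inf, Submodule.mem_iInf]
  exact and_congr_right fun hφ => ⟨fun h a x y b => (h _).2 a x y b (Nat.lt_succ_self _),
    fun h n => ⟨hφ.1, fun a x y b _ => h a x y b⟩⟩

lemma exchOp_of_mem_envFun (hφ : φ ∈ V.envFun A) (hi : i + 1 < n) : V.exchOp A n i φ = φ := by
  funext w
  by_cases hw : w.length = n
  · obtain ⟨a, x, y, b, rfl, ha⟩ := exists_eq_append_cons_cons (hw ▸ hi)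
    rw [exchOp_append_cons_cons ha hw, ← (mem_envFun.1 hφ).2]
  · exact exchOp_apply_of_length_ne hw

lemma unit_bracket {p m : ℤ} (h : 0 + p = m) (x : V.cpx.X p) : V.bracket h V.unit x = 0 := by
  rw [V.bracket_antisymm h (by omega : p + 0 = m), V.bracket_unit, smul_zero, neg_zero]

lemma exchOp_append_unit_cons (hφ : IsMultilinear φ) {a b : List (Letter V.cpx)}
    {y : Letter V.cpx} (hn : (a ++ b).length = n) :
    V.exchOp A (n + 2) a.length φ (a ++ ⟨0, V.unit⟩ :: y :: b) =
      φ (a ++ y :: ⟨0, V.unit⟩ :: b) := by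
  rw [exchOp_append_cons_cons rfl (by simp at hn ⊢; omega), br, unit_bracket, (hφ a b _).map_zero,
    add_zero, koszul, zero_mul, Int.negOnePow_zero, one_smul]

/-- The cycle moves the unit to the position `a.length`. -/
lemma cyc_exchOp_unit_cons_append (hφ : IsMultilinear φ) (a b : List (Letter V.cpx))
    (hn : (a ++ b).length = n) :
    cyc (V.exchOp A (n + 1)) a.length φ (⟨0, V.unit⟩ :: (a ++ b)) =
      φ (a ++ ⟨0, V.unit⟩ :: b) := by
  induction a using List.reverseRecOn generalizing φ b with
  | nil => rfl
  | append_singleton a y ih =>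
    obtain ⟨m, rfl⟩ : ∃ m, n = m + 1 := ⟨(a ++ b).length, by simp at hn ⊢; omega⟩
    rw [List.length_append, List.length_singleton, cyc_succ, List.append_assoc,
      List.singleton_append, Module.End.mul_apply, ih (hφ.exchOp _ _) (y :: b) (by simpa using hn),
      exchOp_append_unit_cons hφ (by simp at hn ⊢; omega), List.append_assoc,
      List.singleton_append]

lemma exchOp_succ_unit_cons (w : List (Letter V.cpx)) :
    V.exchOp A (n + 1) (i + 1) φ (⟨0, V.unit⟩ :: w) =
      V.exchOp A n i (fun l => φ (⟨0, V.unit⟩ :: l)) w :=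
  if_congr Nat.succ_inj rfl rfl

lemma cyc_exchOp_apply_of_length_ne {w : List (Letter V.cpx)} (hw : w.length ≠ n) (k : ℕ) :
    cyc (V.exchOp A n) k φ w = φ w := by
  induction k generalizing φ with
  | zero => rfl
  | succ k ih =>
    rw [cyc_succ, Module.End.mul_apply, ih, exchOp_apply_of_length_ne hw]

lemma pbwOp_mem {N : Submodule K (List (Letter V.cpx) → A)}
    (h : ∀ n i, ∀ φ ∈ N, V.exchOp A n i φ ∈ N) (n : ℕ) (hψ : ψ ∈ N) : V.pbwOp A n ψ ∈ N := by
  induction n with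
  | zero => exact hψ
  | succ n ih => exact avg_mem (s := V.exchOp A (n + 1)) (n := n + 1) (fun i _ => h (n + 1) i) _ ih

variable [CharZero K]

lemma avg_exchOp_apply_of_length_ne {w : List (Letter V.cpx)} (hw : w.length ≠ n) :
    avg K (V.exchOp A n) n φ w = φ w :=
  (map_avg (J := LinearMap.proj (φ := fun _ => A) w) (s' := fun _ => 1)
    (fun _ _ _ => exchOp_apply_of_length_ne hw) φ).trans
    (avg_smul_of_fixed (R := Module.End K A) (m := φ w) fun _ _ => rfl)

lemma avg_exchOp_mem_stage_succ (hφ : φ ∈ V.stage A n) :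
    avg K (V.exchOp A n) n φ ∈ V.stage A (n + 1) := by
  set s := fun i => (V.exchOp A n i).restrict fun _ hφ => exchOp_mem_stage hφ i
  have coe_avg : (avg K s n ⟨φ, hφ⟩ : List (Letter V.cpx) → A) = avg K (V.exchOp A n) n φ :=
    map_avg (J := (V.stage A n).subtype) (fun _ _ _ => rfl) ⟨φ, hφ⟩
  rw [← coe_avg]
  refine ⟨(avg K s n ⟨φ, hφ⟩).2.1, fun a x y b hn => ?_⟩
  obtain hn | hn := (Nat.lt_succ_iff.1 hn).lt_or_eq
  · exact (avg K s n ⟨φ, hφ⟩).2.2 a x y b hn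
  · have fixed := congrArg (fun t => (t ⟨φ, hφ⟩ : List (Letter V.cpx) → A) (a ++ x :: y :: b))
      ((V.isCoxeter_exchOp A n).mul_avg (K := K) (i := a.length)
        (by rw [← hn]; simp only [List.length_append, List.length_cons]; omega))
    exact fixed.symm.trans (exchOp_append_cons_cons rfl hn)

lemma pbwOp_mem_stage_succ (hψ : IsMultilinear ψ) (n : ℕ) : V.pbwOp A n ψ ∈ V.stage A (n + 1) := by
  induction n with
  | zero => exact ⟨hψ, fun a x y b hn => by simp at hn⟩
  | succ n ih => exact avg_exchOp_mem_stage_succ ih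

lemma pbwOp_apply_of_lt {w : List (Letter V.cpx)} (hw : n < w.length) : V.pbwOp A n ψ w = ψ w := by
  induction n with
  | zero => rfl
  | succ n ih =>
    exact (avg_exchOp_apply_of_length_ne hw.ne').trans (ih (Nat.lt_of_succ_lt hw))

lemma pbwOp_apply_of_le {w : List (Letter V.cpx)} (hw : w.length ≤ n) :
    V.pbwOp A n ψ w = V.pbw A ψ w := by
  induction n, hw using Nat.le_induction with
  | base => rfl
  | succ n hw ih => exact (avg_exchOp_apply_of_length_ne (Nat.lt_succ_of_le hw).ne).trans ih

lemma pbw_of_mem_envFun (hψ : ψ ∈ V.envFun A) : V.pbw A ψ = ψ := by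
  suffices h : ∀ n, V.pbwOp A n ψ = ψ from funext fun w => congrFun (h w.length) w
  intro n
  induction n with
  | zero => rfl
  | succ n ih =>
    rw [pbwOp, Module.End.mul_apply, ih, ← Module.End.smul_def]
    exact avg_smul_of_fixed fun i hi => exchOp_of_mem_envFun hψ hi

lemma isMultilinear_pbw (hψ : IsMultilinear ψ) : IsMultilinear (V.pbw A ψ) := by
  intro a b p
  have h : ∀ x : V.cpx.X p, V.pbw A ψ (a ++ ⟨p, x⟩ :: b) =
      V.pbwOp A (a.length + (b.length + 1)) ψ (a ++ ⟨p, x⟩ :: b) := fun x =>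
    (pbwOp_apply_of_le (by simp)).symm
  simpa only [h] using (pbwOp_mem_stage_succ hψ _).1 a b p

lemma pbw_exchange (hψ : IsMultilinear ψ) (a : List (Letter V.cpx)) (x y : Letter V.cpx)
    (b : List (Letter V.cpx)) : V.pbw A ψ (a ++ x :: y :: b) =
      koszul x y • V.pbw A ψ (a ++ y :: x :: b) + V.pbw A ψ (a ++ V.br x y :: b) := by
  have hlen : (a ++ x :: y :: b).length = a.length + (b.length + 2) := by simp
  rw [← pbwOp_apply_of_le hlen.le, ← pbwOp_apply_of_le (n := a.length + (b.length + 2)) (by simp),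
    ← pbwOp_apply_of_le (n := a.length + (b.length + 2)) (by simp)]
  exact (pbwOp_mem_stage_succ hψ _).2 a x y b (by omega)

lemma pbwOp_succ_unit_cons (hψ : ψ ∈ V.unitalFun A) (w : List (Letter V.cpx)) :
    V.pbwOp A (n + 1) ψ (⟨0, V.unit⟩ :: w) = V.pbwOp A n ψ w := by
  let J : Module.End K (List (Letter V.cpx) → A) := LinearMap.funLeft K A (List.cons ⟨0, V.unit⟩)
  suffices h : J (V.pbwOp A (n + 1) ψ) = V.pbwOp A n ψ from congrFun h w
  have J_avg (m : ℕ) : J (V.pbwOp A (m + 1) ψ) = avg K (V.exchOp A m) m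
      ((m + 1 : K)⁻¹ • ∑ k ∈ Finset.range (m + 1),
        J (cyc (V.exchOp A (m + 1)) k (V.pbwOp A m ψ))) := by
    rw [pbwOp, avg, mul_assoc, Module.End.mul_apply,
      map_avg fun i _ φ => funext fun w => exchOp_succ_unit_cons w]
    simp only [Module.End.mul_apply, LinearMap.smul_apply, LinearMap.sum_apply, map_smul, map_sum]
  induction n with
  | zero =>
    rw [J_avg, avg, Module.End.one_apply, Nat.cast_zero, zero_add, zero_add, inv_one, one_smul,
      Finset.sum_range_one]
    exact funext (hψ.2 [])
  | succ n ih =>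
    have J_cyc : ∀ k ∈ Finset.range (n + 2),
        J (cyc (V.exchOp A (n + 2)) k (V.pbwOp A (n + 1) ψ)) = V.pbwOp A n ψ := by
      intro k hk
      funext w
      by_cases hw : w.length = n + 1
      · obtain ⟨a, b, rfl, rfl⟩ : ∃ a b, w = a ++ b ∧ a.length = k :=
          ⟨w.take k, w.drop k, (List.take_append_drop k w).symm,
            by simp at hk ⊢; omega⟩
        rw [pbwOp_apply_of_lt (by omega)]
        refine (cyc_exchOp_unit_cons_append (pbwOp_mem_stage_succ hψ.1 _).1 a b hw).trans ?_
        rw [pbwOp_apply_of_lt (by simp at hw ⊢; omega), hψ.2]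
      · exact (cyc_exchOp_apply_of_length_ne (by simpa using hw) k).trans (congrFun ih w)
    rw [J_avg, Finset.sum_congr rfl J_cyc, Finset.sum_const, Finset.card_range,
      ← Nat.cast_smul_eq_nsmul K, smul_smul, Nat.cast_succ (n + 1),
      inv_mul_cancel₀ (Nat.cast_add_one_ne_zero (n + 1)), one_smul]
    rfl

lemma pbw_mem_envFun (hψ : ψ ∈ V.unitalFun A) : V.pbw A ψ ∈ V.envFun A := by
  have exchange := pbw_exchange hψ.1
  have multilinear := isMultilinear_pbw hψ.1
  refine mem_envFun.2 ⟨⟨multilinear, fun a => ?_⟩, exchange⟩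
  induction a using List.reverseRecOn with
  | nil => exact fun b => pbwOp_succ_unit_cons hψ b
  | append_singleton a y ih =>
    intro b
    rw [List.append_assoc, List.append_assoc, List.singleton_append, List.singleton_append,
      exchange, br, V.bracket_unit, (multilinear a b _).map_zero, add_zero, ih, koszul, mul_zero,
      Int.negOnePow_zero, one_smul]

end ULie
end Symmetrization

section Naturality

variable {K : Type u} [Field K] [CharZero K] {V : ULie K} {W : ULie K} {A B : Type*}
  [AddCommGroup A] [Module K A] [AddCommGroup B] [Module K B]

namespace ULie

lemma pbw_natural {J : (List (Letter V.cpx) → A) →ₗ[K] List (Letter W.cpx) → B}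
    (hlocal : ∀ φ ψ w, (∀ v, v.length = w.length → φ v = ψ v) → J φ w = J ψ w)
    (hexch : ∀ φ i, IsMultilinear φ → J (V.exch φ i) = W.exch (J φ) i)
    {ψ : List (Letter V.cpx) → A} (hψ : IsMultilinear ψ) : J (V.pbw A ψ) = W.pbw B (J ψ) := by
  have J_exchOp (n i : ℕ) (φ : List (Letter V.cpx) → A) (hφ : IsMultilinear φ) :
      J (V.exchOp A n i φ) = W.exchOp B n i (J φ) := by
    funext w
    by_cases hw : w.length = n
    · rw [exchOp_apply_of_length_eq hw, ← hexch φ i hφ]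
      exact hlocal _ _ w fun v hv => exchOp_apply_of_length_eq (hv.trans hw)
    · rw [exchOp_apply_of_length_ne hw]
      exact hlocal _ _ w fun v hv => exchOp_apply_of_length_ne (hv.trans_ne hw)
  have J_pbwOp (n : ℕ) : J (V.pbwOp A n ψ) = W.pbwOp B n (J ψ) := by
    induction n with
    | zero => rfl
    | succ n ih =>
      have h := avg_rel (P := (IsMultilinear.submodule V.cpx A).prod ⊤ ⊓ J.graph)
        (s := V.exchOp A (n + 1)) (s' := W.exchOp B (n + 1)) (n := n + 1)
        (fun i _ z hz => ⟨⟨hz.1.1.exchOp _ i, trivial⟩,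
          (congrArg (W.exchOp B (n + 1) i) hz.2).trans (J_exchOp _ i _ hz.1.1).symm⟩)
        (V.pbwOp A n ψ, W.pbwOp B n (J ψ)) ⟨⟨(pbwOp_mem_stage_succ hψ n).1, trivial⟩, ih.symm⟩
      exact h.2.symm
  funext w
  exact (hlocal _ _ w fun v hv => (pbwOp_apply_of_le hv.le).symm).trans
    (congrFun (J_pbwOp w.length) w)

end ULie

end Naturality

/-! ### Linear maps out of the enveloping algebra -/

section Env

variable {K : Type u} [Field K] (V : ULie K) {A : Type*} [AddCommGroup A] [Module K A]

namespace ULie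

/-- The product in the enveloping algebra of the letters of a word. -/
def word (w : List (Letter V.cpx)) : V.Env := (w.map fun x => V.gen x.1 x.2).prod

@[simp] lemma word_nil : V.word [] = 1 := rfl

lemma word_cons (x : Letter V.cpx) (w : List (Letter V.cpx)) :
    V.word (x :: w) = V.gen x.1 x.2 * V.word w := by simp [ULie.word]

lemma word_append (w w' : List (Letter V.cpx)) :
    V.word (w ++ w') = V.word w * V.word w' := by simp [ULie.word]

lemma isMultilinear_word : IsMultilinear V.word := fun a b p => by
  simp only [V.word_append, V.word_cons]
  exact ((LinearMap.mulLeft K (V.word a)).comp ((LinearMap.mulRight K (V.word b)).comp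
    (V.gen p))).isLinear

lemma word_unit (a b : List (Letter V.cpx)) :
    V.word (a ++ ⟨0, V.unit⟩ :: b) = V.word (a ++ b) := by
  simp only [V.word_append, V.word_cons]
  rw [V.gen_unit, one_mul]

lemma word_exchange (a : List (Letter V.cpx)) (x y : Letter V.cpx) (b : List (Letter V.cpx)) :
    V.word (a ++ x :: y :: b) = koszul x y • V.word (a ++ y :: x :: b) +
      V.word (a ++ V.br x y :: b) := by
  simp only [V.word_append, V.word_cons]
  rw [ULie.br, V.gen_bracket, sub_mul, mul_sub, sign_mul_left, sign_mul_right, mul_assoc, mul_assoc]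
  exact (add_sub_cancel _ _).symm

lemma span_word : Submodule.span K (Set.range V.word) = ⊤ := by
  refine Submodule.eq_top_iff'.2 fun z => ?_
  induction z using ULie.Env.induction with
  | scalar k =>
    rw [Algebra.algebraMap_eq_smul_one]
    exact Submodule.smul_mem _ _ (Submodule.subset_span ⟨[], rfl⟩)
  | gen p x => exact Submodule.subset_span ⟨[⟨p, x⟩], by simp [V.word_cons]⟩
  | mul a b ha hb =>
    induction ha using Submodule.span_induction with
    | mem a ha =>
      obtain ⟨w, rfl⟩ := ha
      induction hb using Submodule.span_induction with
      | mem b hb =>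
        obtain ⟨w', rfl⟩ := hb
        exact Submodule.subset_span ⟨w ++ w', V.word_append w w'⟩
      | zero => simp
      | add x y _ _ hx hy => rw [mul_add]; exact add_mem hx hy
      | smul c x _ hx => rw [mul_smul_comm]; exact Submodule.smul_mem _ _ hx
    | zero => simp
    | add x y _ _ hx hy => rw [add_mul]; exact add_mem hx hy
    | smul c x _ hx => rw [smul_mul_assoc]; exact Submodule.smul_mem _ _ hx
  | add a b ha hb => exact add_mem ha hb

variable {V} in
lemma env_hom_ext {f g : V.Env →ₗ[K] A} (h : ∀ w, f (V.word w) = g (V.word w)) : f = g :=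
  LinearMap.ext_on V.span_word (by rintro _ ⟨w, rfl⟩; exact h w)

lemma isWord_iff {n : ℤ} {a : V.Env} :
    V.IsWord n a ↔ ∃ w, wordDeg w = n ∧ V.word w = a := by
  constructor
  · intro h
    induction h with
    | one => exact ⟨[], rfl, rfl⟩
    | @cons p q n h x a _ ih =>
      obtain ⟨w, hw, rfl⟩ := ih
      exact ⟨⟨p, x⟩ :: w, by rw [← h, ← hw]; rfl, V.word_cons _ _⟩
  · rintro ⟨w, rfl, rfl⟩
    induction w with
    | nil => exact .one
    | cons x w ih => rw [V.word_cons]; exact .cons rfl x.2 ih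

lemma word_mem_grade (w : List (Letter V.cpx)) : V.word w ∈ V.grade (wordDeg w) :=
  (V.isWord_iff.2 ⟨w, rfl, rfl⟩).mem_grade

variable {V} in
lemma grade_le_of_word {n : ℤ} {S : Submodule K V.Env}
    (h : ∀ w, wordDeg w = n → V.word w ∈ S) : V.grade n ≤ S :=
  V.grade_le fun a ha => by
    obtain ⟨w, hw, rfl⟩ := V.isWord_iff.1 ha
    exact h w hw

lemma word_mem_envFun : V.word ∈ V.envFun V.Env :=
  mem_envFun.2 ⟨⟨V.isMultilinear_word, V.word_unit⟩, V.word_exchange⟩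

variable (A) in
/-- The action of the homogeneous elements on `V.envFun A` by appending letters. -/
def appendLetter (p : ℤ) : V.cpx.X p →ₗ[K] Module.End K (V.envFun A) :=
  LinearMap.mk₂ K (fun x φ => ⟨fun w => φ.1 (w ++ [⟨p, x⟩]), mem_envFun.2 ⟨⟨fun a b q => by
      simpa only [List.append_assoc, List.cons_append] using φ.2.1.1 a (b ++ [⟨p, x⟩]) q,
    fun a b => by
      simpa only [List.append_assoc, List.cons_append] using φ.2.1.2 a (b ++ [⟨p, x⟩])⟩,
    fun a y z b => by
      simpa only [List.append_assoc, List.cons_append] using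
        (mem_envFun.1 φ.2).2 a y z (b ++ [⟨p, x⟩])⟩⟩)
    (fun x y φ => Subtype.ext (funext fun w => (φ.2.1.1 w [] p).map_add x y))
    (fun c x φ => Subtype.ext (funext fun w => (φ.2.1.1 w [] p).map_smul c x))
    (fun _ _ _ => rfl) (fun _ _ _ => rfl)

lemma appendLetter_apply {p : ℤ} (x : V.cpx.X p) (φ : V.envFun A)
    (w : List (Letter V.cpx)) : (V.appendLetter A p x φ).1 w = φ.1 (w ++ [⟨p, x⟩]) := rfl

lemma envFun_sign_smul (e : ℤˣ) (φ : V.envFun A) (w : List (Letter V.cpx)) :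
    (e • φ).1 w = e • φ.1 w := by
  obtain rfl | rfl := Int.units_eq_one_or e <;> simp

variable (A) in
lemma appendLetter_bracket {p q n : ℤ} (h : p + q = n) (x : V.cpx.X p) (y : V.cpx.X q) :
    V.appendLetter A n (V.bracket h x y) = V.appendLetter A p x * V.appendLetter A q y -
      (p * q).negOnePow • (V.appendLetter A q y * V.appendLetter A p x) := by
  refine LinearMap.ext fun φ => Subtype.ext (funext fun w => ?_)
  rw [LinearMap.sub_apply, sign_smul_apply, Module.End.mul_apply, Module.End.mul_apply]
  change _ = (V.appendLetter A p x (V.appendLetter A q y φ)).1 w -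
    ((p * q).negOnePow • (V.appendLetter A q y (V.appendLetter A p x φ))).1 w
  rw [envFun_sign_smul]
  simp only [V.appendLetter_apply, List.append_assoc, List.cons_append, List.nil_append]
  rw [(mem_envFun.1 φ.2).2 w ⟨p, x⟩ ⟨q, y⟩ [], V.br_mk h]
  exact (add_sub_cancel_left _ _).symm

variable (A) in
lemma appendLetter_unit : V.appendLetter A 0 V.unit = 1 :=
  LinearMap.ext fun φ => Subtype.ext (funext fun w => by
    rw [V.appendLetter_apply, φ.2.1.2, List.append_nil]; rfl)

variable (A) in
/-- The action of the enveloping algebra on `V.envFun A`. -/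
def envFunAction : V.Env →ₐ[K] Module.End K (V.envFun A) :=
  ULie.Env.lift V (B := Module.End K (V.envFun A)) (V.appendLetter A) (V.appendLetter_bracket A)
    (V.appendLetter_unit A)

lemma envFunAction_gen {p : ℤ} (x : V.cpx.X p) :
    V.envFunAction A (V.gen p x) = V.appendLetter A p x := by
  rw [ULie.envFunAction, ULie.Env.lift_gen]

/-- The linear map on the enveloping algebra induced by a function on words. -/
def descend (φ : V.envFun A) : V.Env →ₗ[K] A :=
  (LinearMap.proj (R := K) (φ := fun _ : List (Letter V.cpx) => A) []).comp
    ((V.envFun A).subtype.comp ((LinearMap.applyₗ φ).comp (V.envFunAction A).toLinearMap))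

lemma descend_word (φ : V.envFun A) (w : List (Letter V.cpx)) :
    V.descend φ (V.word w) = φ.1 w := by
  suffices h : ∀ v, (V.envFunAction A (V.word w) φ).1 v = φ.1 (v ++ w) from h []
  induction w with
  | nil => intro v; rw [V.word_nil, map_one, List.append_nil]; rfl
  | cons x w ih =>
    intro v
    rw [V.word_cons, map_mul, Module.End.mul_apply, V.envFunAction_gen,
      V.appendLetter_apply]
    refine (ih _).trans ?_
    rw [List.append_assoc]
    rfl

end ULie
end Env

/-! ### Letterwise operations -/

section Letters

variable {K : Type u} [Field K] {E F : Ch K} {A : Type*}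

lemma d_map_apply (g : E ⟶ F) {i j : ℤ} (x : E.X i) : F.d i j (g.f i x) = g.f j (E.d i j x) := by
  rw [← ModuleCat.comp_apply, g.comm, ModuleCat.comp_apply]

/-- The image of a homogeneous element under a chain map. -/
def mapLetter (g : E ⟶ F) (x : Letter E) : Letter F := ⟨x.1, g.f x.1 x.2⟩

/-- The differential of a homogeneous element. -/
def letterDiff (x : Letter E) : Letter E := ⟨x.1 - 1, E.d x.1 (x.1 - 1) x.2⟩

lemma mapLetter_letterDiff (g : E ⟶ F) (x : Letter E) :
    mapLetter g (letterDiff x) = letterDiff (mapLetter g x) :=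
  congrArg (Sigma.mk (x.1 - 1)) (d_map_apply g x.2).symm

lemma wordDeg_map_mapLetter (g : E ⟶ F) (w : List (Letter E)) :
    wordDeg (w.map (mapLetter g)) = wordDeg w := by
  simp only [wordDeg, List.map_map]; rfl

lemma koszul_letterDiff (x y : Letter E) :
    koszul (letterDiff x) y = koszul x y * y.1.negOnePow := by
  rw [koszul, koszul, letterDiff, sub_mul, one_mul, Int.negOnePow_sub]

variable [AddCommGroup A] [Module K A]

lemma IsMultilinear.comp_map_mapLetter {φ : List (Letter F) → A} (hφ : IsMultilinear φ)
    (g : E ⟶ F) : IsMultilinear fun w => φ (w.map (mapLetter g)) := fun a b p => by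
  simp only [List.map_append, List.map_cons]
  exact ((hφ (a.map (mapLetter g)) (b.map (mapLetter g)) p).mk' _ ∘ₗ (g.f p).hom).isLinear

/-- The sum, with Koszul signs, of the values of a function on the words in which one letter of the
given word is replaced by its differential. -/
def wordDiffAt : List (Letter E) → ((List (Letter E) → A) →ₗ[K] A)
  | [] => 0
  | x :: l => LinearMap.proj (letterDiff x :: l) +
      x.1.negOnePow • (wordDiffAt l ∘ₗ LinearMap.funLeft K A (x :: ·))

variable (E A) in
/-- The transpose of the differential on words, see `ULie.diff_word`. -/
def wordDiff : Module.End K (List (Letter E) → A) := LinearMap.pi wordDiffAt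

lemma wordDiff_nil (φ : List (Letter E) → A) : wordDiff E A φ [] = 0 := rfl

lemma wordDiff_cons (φ : List (Letter E) → A) (x : Letter E) (l : List (Letter E)) :
    wordDiff E A φ (x :: l) = φ (letterDiff x :: l) +
      x.1.negOnePow • wordDiff E A (fun l => φ (x :: l)) l := by
  change (_ + x.1.negOnePow • (wordDiffAt l ∘ₗ LinearMap.funLeft K A (x :: ·))) φ = _
  rw [LinearMap.add_apply, sign_smul_apply]
  rfl

lemma wordDiff_congr {φ ψ : List (Letter E) → A} {w : List (Letter E)}
    (h : ∀ v, v.length = w.length → φ v = ψ v) : wordDiff E A φ w = wordDiff E A ψ w := by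
  induction w generalizing φ ψ with
  | nil => rfl
  | cons x l ih =>
    rw [wordDiff_cons, wordDiff_cons, h (letterDiff x :: l) rfl,
      ih fun v hv => h (x :: v) (congrArg (· + 1) hv)]

lemma wordDiff_comp {B : Type*} [AddCommGroup B] [Module K B] (g : A →ₗ[K] B)
    (φ : List (Letter E) → A) (w : List (Letter E)) :
    wordDiff E B (fun w => g (φ w)) w = g (wordDiff E A φ w) := by
  induction w generalizing φ with
  | nil => exact (map_zero g).symm
  | cons x l ih => rw [wordDiff_cons, wordDiff_cons, map_add, map_sign_smul, ih]

lemma wordDiff_comp_map_mapLetter (g : E ⟶ F) (φ : List (Letter F) → A) (w : List (Letter E)) :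
    wordDiff E A (fun w => φ (w.map (mapLetter g))) w =
      wordDiff F A φ (w.map (mapLetter g)) := by
  induction w generalizing φ with
  | nil => rfl
  | cons x l ih =>
    rw [List.map_cons, wordDiff_cons, wordDiff_cons, ← mapLetter_letterDiff]
    exact congrArg (fun t => _ + x.1.negOnePow • t) (ih fun l => φ (mapLetter g x :: l))

end Letters

section LettersULie

variable {K : Type u} [Field K] {V W : ULie K} {A : Type*} [AddCommGroup A]

namespace ULie

lemma mapLetter_br (f : V ⟶ W) (x y : Letter V.cpx) :
    mapLetter f.hom (V.br x y) = W.br (mapLetter f.hom x) (mapLetter f.hom y) :=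
  congrArg (Sigma.mk (x.1 + y.1)) (f.map_bracket rfl x.2 y.2)

lemma exch_comp_map_mapLetter (f : V ⟶ W) (φ : List (Letter W.cpx) → A) (i : ℕ)
    (w : List (Letter V.cpx)) :
    V.exch (fun w => φ (w.map (mapLetter f.hom))) i w =
      W.exch φ i (w.map (mapLetter f.hom)) := by
  induction i generalizing φ w with
  | zero =>
    match w with
    | [] | [_] => rfl
    | x :: y :: l => simp only [exch, List.map_cons, mapLetter_br]; rfl
  | succ i ih =>
    match w with
    | [] => rfl
    | x :: l => exact ih (fun l => φ (mapLetter f.hom x :: l)) l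

variable [Module K A]

lemma comp_map_mapLetter_mem_unitalFun {ψ : List (Letter W.cpx) → A} (hψ : ψ ∈ W.unitalFun A)
    {g : V.cpx ⟶ W.cpx} (hg : g.f 0 V.unit = W.unit) :
    (fun w => ψ (w.map (mapLetter g))) ∈ V.unitalFun A := by
  refine ⟨hψ.1.comp_map_mapLetter g, fun a b => ?_⟩
  have hunit : mapLetter g ⟨0, V.unit⟩ = ⟨0, W.unit⟩ := congrArg (Sigma.mk 0) hg
  simpa only [List.map_append, List.map_cons, hunit] using
    hψ.2 (a.map (mapLetter g)) (b.map (mapLetter g))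

lemma exch_comp {B : Type*} [AddCommGroup B] [Module K B] (g : A →ₗ[K] B)
    (φ : List (Letter V.cpx) → A) (i : ℕ) (w : List (Letter V.cpx)) :
    V.exch (fun w => g (φ w)) i w = g (V.exch φ i w) := by
  induction i generalizing φ w with
  | zero =>
    match w with
    | [] | [_] => rfl
    | x :: y :: l => simp only [exch, map_add, map_sign_smul]
  | succ i ih =>
    match w with
    | [] => rfl
    | x :: l => exact ih (fun l => φ (x :: l)) l

lemma exch_mem {S : ℤ → Submodule K A} {φ : List (Letter V.cpx) → A}
    (h : ∀ w, φ w ∈ S (wordDeg w)) (i : ℕ) (w : List (Letter V.cpx)) :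
    V.exch φ i w ∈ S (wordDeg w) := by
  induction i generalizing φ S w with
  | zero =>
    match w with
    | [] | [_] => exact h _
    | x :: y :: l =>
      have hswap := h (y :: x :: l)
      have hbr := h (V.br x y :: l)
      rw [wordDeg_cons, wordDeg_cons] at hswap ⊢
      rw [wordDeg_cons, br, add_assoc] at hbr
      rw [add_left_comm] at hswap
      exact add_mem ((S _).smul_of_tower_mem _ hswap) hbr
  | succ i ih =>
    match w with
    | [] => exact h _
    | x :: l =>
      rw [wordDeg_cons]
      exact ih (S := fun n => S (x.1 + n)) (fun w => wordDeg_cons x w ▸ h (x :: w)) l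

lemma diff_word (w : List (Letter V.cpx)) : V.diff (V.word w) = wordDiff V.cpx V.Env V.word w := by
  induction w with
  | nil => exact V.diff_one
  | cons x l ih =>
    simp only [wordDiff_cons, V.word_cons]
    rw [V.diff_gen_mul (sub_add_cancel x.1 1), ih]
    exact congrArg (fun t => _ + x.1.negOnePow • t)
      (wordDiff_comp (LinearMap.mulLeft K (V.gen x.1 x.2)) V.word l).symm

end ULie
end LettersULie

section WordDiffExch

variable {K : Type u} [Field K] {V : ULie K} {A : Type*} [AddCommGroup A] [Module K A]

namespace ULie

lemma apply_letterDiff_br {φ : List (Letter V.cpx) → A} (hφ : IsMultilinear φ)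
    (x y : Letter V.cpx) (l : List (Letter V.cpx)) :
    φ (letterDiff (V.br x y) :: l) =
      φ (V.br (letterDiff x) y :: l) + x.1.negOnePow • φ (V.br x (letterDiff y) :: l) := by
  have hleft : x.1 - 1 + y.1 = x.1 + y.1 - 1 := by omega
  have hright : x.1 + (y.1 - 1) = x.1 + y.1 - 1 := by omega
  rw [letterDiff, letterDiff, letterDiff, V.br_mk hleft, V.br_mk hright]
  let φl := (hφ [] l (x.1 + y.1 - 1)).mk' _
  change φl (V.cpx.d _ _ (V.bracket rfl x.2 y.2)) = _
  rw [V.d_bracket rfl hleft hright (sub_add_cancel _ _) (sub_add_cancel _ _), map_add,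
    map_sign_smul]
  rfl

lemma wordDiff_exch {φ : List (Letter V.cpx) → A} (hφ : IsMultilinear φ) (i : ℕ) :
    wordDiff V.cpx A (V.exch φ i) = V.exch (wordDiff V.cpx A φ) i := by
  funext w
  induction i generalizing φ w with
  | zero =>
    match w with
    | [] => rfl
    | [x] => exact (wordDiff_cons (V.exch φ 0) x []).trans (wordDiff_cons φ x []).symm
    | x :: y :: l =>
      have hinner : wordDiff V.cpx A
          (fun l => koszul x y • φ (y :: x :: l) + φ (V.br x y :: l)) l =
          koszul x y • wordDiff V.cpx A (fun l => φ (y :: x :: l)) l +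
            wordDiff V.cpx A (fun l => φ (V.br x y :: l)) l := by
        rw [← Pi.smul_apply, ← map_sign_smul, ← Pi.add_apply, ← map_add]
        rfl
      have hdiff := koszul_letterDiff y x
      rw [koszul_comm, koszul_comm y] at hdiff
      have hdeg : (V.br x y).1.negOnePow = y.1.negOnePow * x.1.negOnePow := by
        rw [br, Int.negOnePow_add, mul_comm]
      simp only [wordDiff_cons, exch, hinner, apply_letterDiff_br hφ, koszul_letterDiff, hdiff,
        hdeg, smul_add, smul_smul, mul_left_comm x.1.negOnePow, Int.units_mul_self, mul_one,
        mul_comm x.1.negOnePow y.1.negOnePow]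
      rw [mul_comm x.1.negOnePow (koszul x y), mul_left_comm y.1.negOnePow]
      abel
  | succ i ih =>
    match w with
    | [] => rfl
    | x :: l =>
      let L := (V.isLinearMap_exch A i).mk' _
      have hcons : (fun l => wordDiff V.cpx A φ (x :: l)) =
          (fun l => φ (letterDiff x :: l)) +
            x.1.negOnePow • wordDiff V.cpx A (fun l => φ (x :: l)) :=
        funext fun l => wordDiff_cons φ x l
      change _ = L (fun l => wordDiff V.cpx A φ (x :: l)) l
      rw [hcons, map_add, map_sign_smul, wordDiff_cons]
      exact congrArg (fun t => _ + x.1.negOnePow • t) (ih (hφ.tail x) l)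

end ULie
end WordDiffExch

/-! ### Extension of unit-preserving chain maps to enveloping algebras -/

section PbwNatural

variable {K : Type u} [Field K] {V W : ULie K} {A B : Type*}
  [AddCommGroup A] [Module K A] [AddCommGroup B] [Module K B]

namespace ULie

lemma pbw_mem {S : ℤ → Submodule K A} {ψ : List (Letter V.cpx) → A}
    (h : ∀ w, ψ w ∈ S (wordDeg w)) (w : List (Letter V.cpx)) : V.pbw A ψ w ∈ S (wordDeg w) := by
  let N : Submodule K (List (Letter V.cpx) → A) := Submodule.pi Set.univ fun w => S (wordDeg w)
  refine pbwOp_mem (N := N) (fun n i φ hφ v _ => ?_) w.length (fun v _ => h v) w trivial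
  by_cases hv : v.length = n
  · rw [exchOp_apply_of_length_eq hv]
    exact exch_mem (fun w => hφ w trivial) i v
  · rw [exchOp_apply_of_length_ne hv]
    exact hφ v trivial

variable [CharZero K]

lemma pbw_comp (g : A →ₗ[K] B) {ψ : List (Letter V.cpx) → A} (hψ : IsMultilinear ψ)
    (w : List (Letter V.cpx)) : V.pbw B (fun w => g (ψ w)) w = g (V.pbw A ψ w) :=
  (congrFun (pbw_natural (J := g.compLeft _) (fun _ _ w h => congrArg g (h w rfl))
    (fun φ i _ => funext fun w => (exch_comp g φ i w).symm) hψ) w).symm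

lemma pbw_comp_map_mapLetter (f : V ⟶ W) {ψ : List (Letter W.cpx) → A} (hψ : IsMultilinear ψ)
    (w : List (Letter V.cpx)) : V.pbw A (fun w => ψ (w.map (mapLetter f.hom))) w =
      W.pbw A ψ (w.map (mapLetter f.hom)) :=
  (congrFun (pbw_natural (J := LinearMap.funLeft K A (List.map (mapLetter f.hom)))
    (fun _ _ w h => h _ (w.length_map _))
    (fun φ i _ => funext fun w => (exch_comp_map_mapLetter f φ i w).symm) hψ) w).symm

lemma pbw_wordDiff {ψ : List (Letter V.cpx) → A} (hψ : IsMultilinear ψ) :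
    V.pbw A (wordDiff V.cpx A ψ) = wordDiff V.cpx A (V.pbw A ψ) :=
  (pbw_natural (fun _ _ _ => wordDiff_congr) (fun _ i hφ => wordDiff_exch hφ i) hψ).symm

/-- The linear map on the enveloping algebra defined by symmetrizing a unital multilinear function
on words. -/
def pbwLift {ψ : List (Letter V.cpx) → A} (hψ : ψ ∈ V.unitalFun A) : V.Env →ₗ[K] A :=
  V.descend ⟨V.pbw A ψ, pbw_mem_envFun hψ⟩

variable {ψ : List (Letter V.cpx) → A} (hψ : ψ ∈ V.unitalFun A)

lemma pbwLift_word (w : List (Letter V.cpx)) : pbwLift hψ (V.word w) = V.pbw A ψ w :=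
  V.descend_word _ w

lemma pbwLift_diff_word (w : List (Letter V.cpx)) :
    pbwLift hψ (V.diff (V.word w)) = V.pbw A (wordDiff V.cpx A ψ) w := by
  rw [pbw_wordDiff hψ.1, diff_word, ← wordDiff_comp]
  simp only [pbwLift_word]

lemma pbwLift_mem {S : ℤ → Submodule K A} (h : ∀ w, ψ w ∈ S (wordDeg w)) {n : ℤ} {z : V.Env}
    (hz : z ∈ V.grade n) : pbwLift hψ z ∈ S n := by
  refine grade_le_of_word (S := (S n).comap (pbwLift hψ)) (fun w hw => ?_) hz
  rw [Submodule.mem_comap, pbwLift_word, ← hw]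
  exact pbw_mem h w

end ULie
end PbwNatural

section PbwMap

variable {K : Type u} [Field K] {U V W : ULie K} {E : Ch K}

namespace ULie

/-- The product in the enveloping algebra of the images of the letters of a word. -/
def wordMap (W : ULie K) (g : E ⟶ W.cpx) (w : List (Letter E)) : W.Env :=
  W.word (w.map (mapLetter g))

lemma wordMap_cons (g : E ⟶ W.cpx) (x : Letter E) (w : List (Letter E)) :
    W.wordMap g (x :: w) = W.gen x.1 (g.f x.1 x.2) * W.wordMap g w := W.word_cons _ _

lemma isMultilinear_wordMap (g : E ⟶ W.cpx) : IsMultilinear (W.wordMap g) :=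
  W.isMultilinear_word.comp_map_mapLetter g

lemma wordMap_mem_grade (g : E ⟶ W.cpx) (w : List (Letter E)) :
    W.wordMap g w ∈ W.grade (wordDeg w) :=
  wordDeg_map_mapLetter g w ▸ W.word_mem_grade (w.map (mapLetter g))

lemma diff_wordMap (g : E ⟶ W.cpx) (w : List (Letter E)) :
    W.diff (W.wordMap g w) = wordDiff E W.Env (W.wordMap g) w :=
  (W.diff_word _).trans (wordDiff_comp_map_mapLetter g W.word w).symm

lemma wordMap_mem_unitalFun {g : V.cpx ⟶ W.cpx} (hg : g.f 0 V.unit = W.unit) :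
    W.wordMap g ∈ V.unitalFun W.Env :=
  comp_map_mapLetter_mem_unitalFun W.word_mem_envFun.1 hg

lemma wordMap_mem_envFun (f : V ⟶ W) : W.wordMap f.hom ∈ V.envFun W.Env := by
  refine mem_envFun.2 ⟨wordMap_mem_unitalFun f.map_unit, fun a x y b => ?_⟩
  simp only [wordMap, List.map_append, List.map_cons, mapLetter_br]
  exact W.word_exchange _ _ _ _

variable [CharZero K]

/-- The chain map of enveloping algebras induced by a unit-preserving chain map. The extension is
not functorial, see however `pbwMap_comp_hom` and `pbwMap_hom_comp`. -/
def pbwMap (g : V.cpx ⟶ W.cpx) (hg : g.f 0 V.unit = W.unit) : V.envCpx ⟶ W.envCpx where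
  f n := ModuleCat.ofHom ((pbwLift (wordMap_mem_unitalFun hg)).restrict (p := V.grade n)
    (q := W.grade n) fun _ => pbwLift_mem _ (wordMap_mem_grade g))
  comm' i j hij := by
    have hcomm : W.diff ∘ₗ pbwLift (wordMap_mem_unitalFun hg) =
        pbwLift (wordMap_mem_unitalFun hg) ∘ₗ V.diff := env_hom_ext fun w => by
      rw [LinearMap.comp_apply, LinearMap.comp_apply, pbwLift_diff_word, pbwLift_word,
        ← pbw_comp _ (isMultilinear_wordMap g)]
      simp only [diff_wordMap]
    ext z
    refine W.val_injective j ((W.val_d hij _).trans ((LinearMap.congr_fun hcomm _).trans ?_))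
    exact congrArg (pbwLift (wordMap_mem_unitalFun hg)) (V.val_d hij z).symm

lemma pbwLift_wordMap_word (f : V ⟶ W) (w : List (Letter V.cpx)) :
    pbwLift (wordMap_mem_unitalFun f.map_unit) (V.word w) = W.wordMap f.hom w := by
  rw [pbwLift_word, pbw_of_mem_envFun (wordMap_mem_envFun f)]

lemma pbwMap_hom (f : V ⟶ W) : pbwMap f.hom f.map_unit = ((phiShriek K).map f).hom := by
  set L := pbwLift (wordMap_mem_unitalFun f.map_unit)
  have L_gen_mul {p : ℤ} (x : V.cpx.X p) :
      L ∘ₗ LinearMap.mulLeft K (V.gen p x) = LinearMap.mulLeft K (W.gen p (f.hom.f p x)) ∘ₗ L := by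
    refine env_hom_ext fun w => ?_
    rw [LinearMap.comp_apply, LinearMap.comp_apply, LinearMap.mulLeft_apply,
      LinearMap.mulLeft_apply, ← V.word_cons ⟨p, x⟩ w, pbwLift_wordMap_word,
      pbwLift_wordMap_word, wordMap_cons]
  suffices h : ∀ n (z : V.envCpx.X n), L (V.val n z) = mapVal f n z from
    HomologicalComplex.hom_ext _ _ fun n => ModuleCat.hom_ext (LinearMap.ext fun z =>
      W.val_injective n (h n z))
  intro n z
  induction n, z using V.env_induction with
  | one => exact (pbwLift_wordMap_word f []).trans (mapVal_one f).symm
  | gen_mul h x a ih =>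
    rw [mapVal_gen_mul, ← ih]
    exact LinearMap.congr_fun (L_gen_mul x) (V.val _ a)
  | zero n => rw [map_zero, map_zero, map_zero]
  | add n a b ha hb => rw [map_add, map_add, map_add, ha, hb]
  | smul n c a ha => rw [map_smul, map_smul, map_smul, ha]

lemma pbwMap_ext {g : V.cpx ⟶ W.cpx} (hg : g.f 0 V.unit = W.unit) {L : V.envCpx ⟶ W.envCpx}
    {l : V.Env →ₗ[K] W.Env} (hl : ∀ n z, W.val n (L.f n z) = l (V.val n z))
    (h : ∀ w, l (V.word w) = V.pbw W.Env (W.wordMap g) w) : pbwMap g hg = L := by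
  have hlift : pbwLift (wordMap_mem_unitalFun hg) = l :=
    env_hom_ext fun w => (pbwLift_word _ w).trans (h w).symm
  ext n z
  exact W.val_injective n ((LinearMap.congr_fun hlift _).trans (hl n z).symm)

lemma pbwMap_hom_comp (f : U ⟶ V) {g : V.cpx ⟶ W.cpx} (hg : g.f 0 V.unit = W.unit)
    (hfg : (f.hom ≫ g).f 0 U.unit = W.unit) :
    pbwMap (f.hom ≫ g) hfg = pbwMap f.hom f.map_unit ≫ pbwMap g hg := by
  refine pbwMap_ext hfg (l := pbwLift (wordMap_mem_unitalFun hg) ∘ₗ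
    pbwLift (wordMap_mem_unitalFun f.map_unit)) (fun _ _ => rfl) fun w => ?_
  rw [LinearMap.comp_apply, pbwLift_wordMap_word, wordMap, pbwLift_word,
    ← pbw_comp_map_mapLetter f (isMultilinear_wordMap g)]
  simp only [wordMap, List.map_map]
  rfl

lemma pbwMap_comp_hom {g : U.cpx ⟶ V.cpx} (hg : g.f 0 U.unit = V.unit) (f : V ⟶ W)
    (hgf : (g ≫ f.hom).f 0 U.unit = W.unit) :
    pbwMap (g ≫ f.hom) hgf = pbwMap g hg ≫ pbwMap f.hom f.map_unit := by
  refine pbwMap_ext hgf (l := pbwLift (wordMap_mem_unitalFun f.map_unit) ∘ₗ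
    pbwLift (wordMap_mem_unitalFun hg)) (fun _ _ => rfl) fun w => ?_
  rw [LinearMap.comp_apply, pbwLift_word, ← pbw_comp _ (isMultilinear_wordMap g)]
  have hword (w : List (Letter U.cpx)) :
      pbwLift (wordMap_mem_unitalFun f.map_unit) (V.wordMap g w) = W.wordMap (g ≫ f.hom) w :=
    (pbwLift_wordMap_word f _).trans (congrArg W.word (List.map_map ..))
  simp only [hword]

end ULie
end PbwMap

/-! ### Quasi-isomorphisms in semisimple abelian categories -/

section SplitEpi

variable {C : Type*} [Category* C] [Abelian C] [SplitEpiCategory C]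

lemma exists_comp_comp_eq_self {X Y : C} (d : X ⟶ Y) : ∃ k : Y ⟶ X, d ≫ k ≫ d = d := by
  let π := Limits.cokernel.π d
  have : IsSplitEpi π := isSplitEpi_of_epi _
  obtain ⟨A, q, _, x, hx⟩ := (ShortComplex.exact_cokernel d).exact_up_to_refinements
    (𝟙 Y - π ≫ section_ π) (by simp [π])
  have : IsSplitEpi q := isSplitEpi_of_epi q
  refine ⟨section_ q ≫ x, ?_⟩
  have hk : (section_ q ≫ x) ≫ d = 𝟙 Y - π ≫ section_ π := by
    rw [Category.assoc, ← hx, IsSplitEpi.id_assoc]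
  rw [hk, Preadditive.comp_sub, Category.comp_id, Limits.cokernel.condition_assoc,
    Limits.zero_comp, sub_zero]

variable {ι : Type*} {c : ComplexShape ι} {E F : HomologicalComplex C c}

lemma exists_homotopy_id_comp_d_eq_zero (F : HomologicalComplex C c) :
    ∃ p : F ⟶ F, Nonempty (Homotopy p (𝟙 F)) ∧ (∀ i j, p.f i ≫ F.d i j = 0) ∧
      ∀ i j, F.d i j ≫ p.f j = 0 := by
  have exists_inverse (i j : ι) :
      ∃ k : F.X i ⟶ F.X j, F.d j i ≫ k ≫ F.d j i = F.d j i ∧ (¬ c.Rel j i → k = 0) := by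
    by_cases h : c.Rel j i
    · obtain ⟨k, hk⟩ := exists_comp_comp_eq_self (F.d j i)
      exact ⟨k, hk, fun h' => absurd h h'⟩
    · exact ⟨0, by rw [F.shape _ _ h, Limits.zero_comp], fun _ => rfl⟩
  choose k dkd k_zero using exists_inverse
  refine ⟨𝟙 F - Homotopy.nullHomotopicMap k, ⟨?_⟩, fun i j => ?_, fun i j => ?_⟩
  · exact .symm (Homotopy.equivSubZero.symm
      ((Homotopy.ofEq (sub_sub_cancel _ _)).trans (Homotopy.nullHomotopy k k_zero)))
  all_goals
    change _ ≫ _ = (0 : F.X i ⟶ F.X j)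
    by_cases h : c.Rel i j
    swap
    · simp [F.shape _ _ h]
  · change (𝟙 _ - (dNext i k + prevD i k)) ≫ _ = _
    rw [dNext_eq k h]
    simp [prevD, dkd]
  · change _ ≫ (𝟙 _ - (dNext j k + prevD j k)) = _
    rw [prevD_eq k h]
    simp [dNext, dkd]

lemma exists_comp_homotopy_id {f : E ⟶ F}
    (hf : ∀ i, Epi (HomologicalComplex.homologyMap f i)) :
    ∃ g : F ⟶ E, Nonempty (Homotopy (g ≫ f) (𝟙 F)) := by
  obtain ⟨p, ⟨hp⟩, p_d, d_p⟩ := exists_homotopy_id_comp_d_eq_zero F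
  have exists_lift (i : ι) : ∃ (x : F.X i ⟶ E.X i) (y : ∀ j, F.X i ⟶ F.X j),
      x ≫ E.d i (c.next i) = 0 ∧ (∀ j, ¬ c.Rel j i → y j = 0) ∧
        p.f i = y (c.prev i) ≫ F.d (c.prev i) i + x ≫ f.f i := by
    obtain ⟨A, q, _, x, hx, y, hy⟩ := (HomologicalComplex.epi_homologyMap_iff_up_to_refinements
      f _ i _ rfl rfl).1 (hf i) (p.f i) (p_d i _)
    have : IsSplitEpi q := isSplitEpi_of_epi q
    classical
    refine ⟨section_ q ≫ x, fun j => if h : c.Rel j i then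
      section_ q ≫ y ≫ (F.XIsoOfEq (c.prev_eq' h)).hom else 0,
      by rw [Category.assoc, hx, Limits.comp_zero], fun j h => dif_neg h, ?_⟩
    rw [← IsSplitEpi.id_assoc q (p.f i), hy, Preadditive.comp_add, add_comm, Category.assoc]
    congr 1
    by_cases h : c.Rel (c.prev i) i
    · simp [h]
    · rw [F.shape _ _ h, Limits.comp_zero, Limits.comp_zero, Limits.comp_zero]
  choose x y x_d y_zero p_eq using exists_lift
  let g : F ⟶ E :=
    { f i := p.f i ≫ x i
      comm' i j h := by
        obtain rfl := c.next_eq' h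
        rw [Category.assoc, x_d, Limits.comp_zero, reassoc_of% d_p, Limits.zero_comp] }
  have hpg : Homotopy (p ≫ p) (g ≫ f) :=
    { hom i j := p.f i ≫ y i j
      zero i j h := by rw [y_zero i j h, Limits.comp_zero]
      comm i := by
        have hnext : dNext i (fun i j => p.f i ≫ y i j) = 0 := by
          change F.d i _ ≫ p.f _ ≫ y _ i = 0
          rw [reassoc_of% d_p, Limits.zero_comp]
        rw [hnext, zero_add, HomologicalComplex.comp_f]
        nth_rw 2 [p_eq]
        exact (Preadditive.comp_add ..).trans
          (congrArg₂ (· + ·) (Category.assoc _ _ _).symm (Category.assoc _ _ _).symm) }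
  exact ⟨g, ⟨hpg.symm.trans ((hp.compLeftId p).trans hp)⟩⟩

lemma exists_homotopyEquiv_hom_eq (f : E ⟶ F) [QuasiIso f] :
    ∃ e : HomotopyEquiv E F, e.hom = f := by
  obtain ⟨g, ⟨hg⟩⟩ := exists_comp_homotopy_id (f := f) inferInstance
  have : QuasiIso (g ≫ f) := ⟨fun i => by
    rw [quasiIsoAt_iff_isIso_homologyMap, hg.homologyMap_eq]
    infer_instance⟩
  have : QuasiIso g := quasiIso_of_comp_right g f
  obtain ⟨k, ⟨hk⟩⟩ := exists_comp_homotopy_id (f := g) inferInstance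
  have hkf : Homotopy k f :=
    (hg.compLeftId k).symm.trans ((Homotopy.ofEq (Category.assoc _ _ _).symm).trans
      (hk.compRightId f))
  exact ⟨⟨f, g, (hkf.symm.compRight g).trans hk, hg⟩, rfl⟩

end SplitEpi

instance splitEpiCategory_moduleCat {K : Type u} [Field K] :
    SplitEpiCategory (ModuleCat.{v} K) where
  isSplitEpi_of_epi f _ := by
    obtain ⟨s, hs⟩ := f.hom.exists_rightInverse_of_surjective
      (LinearMap.range_eq_top.2 ((ModuleCat.epi_iff_surjective f).1 inferInstance))
    exact ⟨⟨ModuleCat.ofHom s, ModuleCat.hom_ext hs⟩⟩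

section Pointed

variable {C : Type*} [Category* C] [Preadditive C] {ι : Type*} {c : ComplexShape ι}
  {I E F : HomologicalComplex C c}

lemma exists_homotopy_of_sub_eq_comp_sub {q : E ⟶ E} {φ ψ χ ω : E ⟶ F} {η : I ⟶ E}
    (hq : η ≫ q = 0) (h : Homotopy φ ψ) (hsub : χ - ω = q ≫ (φ - ψ)) :
    ∃ h : Homotopy χ ω, ∀ i j, η.f i ≫ h.hom i j = 0 := by
  refine ⟨Homotopy.equivSubZero.symm ((Homotopy.ofEq hsub).trans
    (((Homotopy.equivSubZero h).compLeft q).trans (Homotopy.ofEq Limits.comp_zero))),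
    fun i j => ?_⟩
  have hqi : η.f i ≫ q.f i = 0 := congrArg (fun φ => φ.f i) hq
  simp [Homotopy.equivSubZero, reassoc_of% hqi]

/-- A retraction `ε` of `I` off `F` splits the problem into the copies of `I` in `E` and `F`, on
which the given map is already invertible, and their complements. -/
lemma exists_homotopyInverse_under {η : I ⟶ E} {ε : F ⟶ I} (e : HomotopyEquiv E F)
    (hε : η ≫ e.hom ≫ ε = 𝟙 I) :
    ∃ g : F ⟶ E, (η ≫ e.hom) ≫ g = η ∧
      (∃ h : Homotopy (e.hom ≫ g) (𝟙 E), ∀ i j, η.f i ≫ h.hom i j = 0) ∧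
      ∃ h : Homotopy (g ≫ e.hom) (𝟙 F), ∀ i j, (η ≫ e.hom).f i ≫ h.hom i j = 0 := by
  have hη {G : HomologicalComplex C c} (φ : I ⟶ G) : η ≫ e.hom ≫ ε ≫ φ = φ := by
    simpa using hε =≫ φ
  refine ⟨(𝟙 F - ε ≫ η ≫ e.hom) ≫ e.inv + ε ≫ η, by simp [hη],
    exists_homotopy_of_sub_eq_comp_sub (q := 𝟙 E - e.hom ≫ ε ≫ η) (by simp [hη])
      e.homotopyHomInvId ?_,
    exists_homotopy_of_sub_eq_comp_sub (q := 𝟙 F - ε ≫ η ≫ e.hom) (by simp [hη])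
      e.homotopyInvHomId ?_⟩
  all_goals
    simp only [Preadditive.comp_add, Preadditive.add_comp, Preadditive.comp_sub,
      Preadditive.sub_comp, Category.id_comp, Category.comp_id, Category.assoc]
    abel

end Pointed

section Unit

variable {K : Type u} [Field K] {V W : ULie K}

/-- The monoidal unit of the category of chain complexes. -/
abbrev monUnit (K : Type u) [Field K] : Ch K :=
  (HomologicalComplex.single (ModuleCat.{u} K) _ 0).obj (ModuleCat.of K K)

namespace ULie

variable (V) in
/-- The unit of a unital Lie algebra as a chain map. -/
def unitHom : monUnit K ⟶ V.cpx :=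
  HomologicalComplex.mkHomFromSingle (ModuleCat.ofHom (LinearMap.toSpanSingleton K _ V.unit))
    fun k hk => by
      obtain rfl : k = -1 := by rw [ComplexShape.down_Rel] at hk; omega
      ext
      simpa using V.d_unit

variable (V) in
lemma unitHom_f_zero : V.unitHom.f 0 = (HomologicalComplex.singleObjXSelf _ 0 _).hom ≫
    ModuleCat.ofHom (LinearMap.toSpanSingleton K _ V.unit) :=
  HomologicalComplex.mkHomFromSingle_f _ _

lemma unitHom_f_comp_eq_iff {M : ModuleCat K} {φ : V.cpx.X 0 ⟶ M} {ψ : W.cpx.X 0 ⟶ M} :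
    V.unitHom.f 0 ≫ φ = W.unitHom.f 0 ≫ ψ ↔ φ V.unit = ψ W.unit := by
  rw [unitHom_f_zero, unitHom_f_zero, Category.assoc, Category.assoc, cancel_epi]
  refine ⟨fun h => ?_, fun h => ?_⟩
  · simpa using congrArg (fun φ => φ.hom (1 : K)) h
  · ext
    simpa using h

lemma unitHom_comp_eq_iff {g : V.cpx ⟶ W.cpx} :
    V.unitHom ≫ g = W.unitHom ↔ g.f 0 V.unit = W.unit := by
  refine Iff.trans ⟨fun h => ?_, fun h => ?_⟩ (unitHom_f_comp_eq_iff (ψ := 𝟙 _))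
  · rw [← HomologicalComplex.comp_f, h, Category.comp_id]
  · exact HomologicalComplex.from_single_hom_ext (h.trans (Category.comp_id _))

lemma exists_unitHom_comp_eq_id (h : ∀ v, V.cpx.d 1 0 v ≠ V.unit) :
    ∃ ε : V.cpx ⟶ monUnit K, V.unitHom ≫ ε = 𝟙 _ := by
  obtain ⟨φ, hφ, hd⟩ := Submodule.exists_le_ker_of_notMem
    (p := LinearMap.range (V.cpx.d 1 0).hom) (v := V.unit) (by simpa using h)
  let ε : V.cpx ⟶ monUnit K := HomologicalComplex.mkHomToSingle
    (ModuleCat.ofHom ((φ V.unit)⁻¹ • φ)) fun i hi => by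
      obtain rfl : i = 1 := by rw [ComplexShape.down_Rel] at hi; omega
      ext x
      simpa [hφ] using hd ⟨x, rfl⟩
  refine ⟨ε, HomologicalComplex.from_single_hom_ext ?_⟩
  have hone : ModuleCat.ofHom (LinearMap.toSpanSingleton K _ V.unit) ≫
      ModuleCat.ofHom ((φ V.unit)⁻¹ • φ) = 𝟙 _ := by
    ext
    simp [inv_mul_cancel₀ hφ]
  rw [HomologicalComplex.comp_f, unitHom_f_zero, HomologicalComplex.mkHomToSingle_f,
    Category.assoc, reassoc_of% hone, Iso.hom_inv_id]
  rfl

lemma exists_d_eq_unit (e : HomotopyEquiv V.cpx W.cpx) (he : e.hom.f 0 V.unit = W.unit)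
    {y : W.cpx.X 1} (hy : W.cpx.d 1 0 y = W.unit) : ∃ x, V.cpx.d 1 0 x = V.unit := by
  have h := LinearMap.congr_fun (congrArg ModuleCat.Hom.hom (e.homotopyHomInvId.comm 0)) V.unit
  rw [dNext_eq _ (show (ComplexShape.down ℤ).Rel 0 (-1) from rfl),
    prevD_eq _ (show (ComplexShape.down ℤ).Rel 1 0 from rfl)] at h
  refine ⟨e.inv.f 1 y - e.homotopyHomInvId.hom 0 1 V.unit, ?_⟩
  rw [map_sub, d_map_apply, hy]
  have hinv : e.inv.f 0 W.unit = V.cpx.d 1 0 (e.homotopyHomInvId.hom 0 1 V.unit) + V.unit := by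
    simpa [he, V.d_unit] using h
  rw [hinv, add_sub_cancel_left]

end ULie
end Unit

section PbwHomotopy

variable {K : Type u} [Field K] {V W : ULie K} {E : Ch K}

namespace ULie

/-- The chain homotopy from `L₁` to `L₀` given by a linear map `s` of degree one between the
enveloping algebras. -/
def homotopyOfLinear {L₁ L₀ : V.envCpx ⟶ W.envCpx} (s : V.Env →ₗ[K] W.Env)
    (hs : ∀ n, ∀ z ∈ V.grade n, s z ∈ W.grade (n + 1))
    (h : ∀ n (z : V.envCpx.X n), W.diff (s (V.val n z)) + s (V.diff (V.val n z)) =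
      W.val n (L₁.f n z) - W.val n (L₀.f n z)) : Homotopy L₁ L₀ :=
  let t (i j : ℤ) (hij : (ComplexShape.down ℤ).Rel j i) : V.envCpx.X i ⟶ W.envCpx.X j :=
    ModuleCat.ofHom (s.restrict (p := V.grade i) (q := W.grade j) fun z hz =>
      (show i + 1 = j from hij) ▸ hs i z hz)
  have val_t {i j : ℤ} (hij : (ComplexShape.down ℤ).Rel j i) (z : V.envCpx.X i) :
      W.val j (t i j hij z) = s (V.val i z) := rfl
  have hsub : L₁ - L₀ = Homotopy.nullHomotopicMap' t := by
    ext n z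
    have hn : (ComplexShape.down ℤ).Rel n (n - 1) := sub_add_cancel n 1
    have hn' : (ComplexShape.down ℤ).Rel (n + 1) n := rfl
    refine W.val_injective n ((map_sub (W.val n) _ _).trans ?_)
    rw [← h n z, Homotopy.nullHomotopicMap'_f hn' hn, ← V.val_d hn, ← val_t hn, ← val_t hn',
      ← W.val_d hn', add_comm]
    rfl
  Homotopy.equivSubZero.symm ((Homotopy.ofEq hsub).trans (Homotopy.nullHomotopy' t))

variable {f₁ f₀ : E ⟶ W.cpx}

/-- The extension of a chain homotopy from `f₁` to `f₀` to words, as an `(f₀, f₁)`-derivation. -/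
def wordHomotopy (h : Homotopy f₁ f₀) : List (Letter E) → W.Env
  | [] => 0
  | x :: l => W.gen (x.1 + 1) (h.hom x.1 (x.1 + 1) x.2) * W.wordMap f₁ l +
      x.1.negOnePow • (W.gen x.1 (f₀.f x.1 x.2) * wordHomotopy h l)

variable (h : Homotopy f₁ f₀)

lemma wordHomotopy_cons (x : Letter E) (l : List (Letter E)) : wordHomotopy h (x :: l) =
    W.gen (x.1 + 1) (h.hom x.1 (x.1 + 1) x.2) * W.wordMap f₁ l +
      x.1.negOnePow • (W.gen x.1 (f₀.f x.1 x.2) * wordHomotopy h l) := rfl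

lemma isMultilinear_wordHomotopy : IsMultilinear (wordHomotopy h) := by
  suffices H : ∀ a b p, IsLinearMap K fun x : E.X p => wordHomotopy h (a ++ ⟨p, x⟩ :: b) from H
  intro a b p
  induction a with
  | nil =>
    exact (LinearMap.mulRight K (W.wordMap f₁ b) ∘ₗ W.gen (p + 1) ∘ₗ (h.hom p (p + 1)).hom +
      p.negOnePow • (LinearMap.mulRight K (wordHomotopy h b) ∘ₗ W.gen p ∘ₗ (f₀.f p).hom)).isLinear
  | cons y a ih =>
    exact (LinearMap.mulLeft K (W.gen (y.1 + 1) (h.hom y.1 (y.1 + 1) y.2)) ∘ₗ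
      (isMultilinear_wordMap f₁ a b p).mk' _ + y.1.negOnePow •
        (LinearMap.mulLeft K (W.gen y.1 (f₀.f y.1 y.2)) ∘ₗ ih.mk' _)).isLinear

lemma wordHomotopy_mem_grade (w : List (Letter E)) :
    wordHomotopy h w ∈ W.grade (wordDeg w + 1) := by
  induction w with
  | nil => exact zero_mem _
  | cons x l ih =>
    rw [wordHomotopy_cons, wordDeg_cons]
    exact add_mem (W.gen_mul_mem_grade (by omega) _ (wordMap_mem_grade f₁ l))
      (Submodule.smul_of_tower_mem _ _ (W.gen_mul_mem_grade (by omega) _ ih))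

lemma wordDiff_wordHomotopy_cons (x : Letter E) (l : List (Letter E)) :
    wordDiff E W.Env (fun l => wordHomotopy h (x :: l)) l =
      W.gen (x.1 + 1) (h.hom x.1 (x.1 + 1) x.2) * W.diff (W.wordMap f₁ l) +
        x.1.negOnePow • (W.gen x.1 (f₀.f x.1 x.2) * wordDiff E W.Env (wordHomotopy h) l) := by
  have hsplit : (fun l => wordHomotopy h (x :: l)) =
      (fun l => LinearMap.mulLeft K (W.gen (x.1 + 1) (h.hom x.1 (x.1 + 1) x.2)) (W.wordMap f₁ l)) +
        x.1.negOnePow • fun l =>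
          LinearMap.mulLeft K (W.gen x.1 (f₀.f x.1 x.2)) (wordHomotopy h l) := rfl
  rw [hsplit, map_add, map_sign_smul, Pi.add_apply, Pi.smul_apply, wordDiff_comp, wordDiff_comp,
    ← diff_wordMap]
  rfl

lemma diff_wordHomotopy_add (w : List (Letter E)) :
    W.diff (wordHomotopy h w) + wordDiff E W.Env (wordHomotopy h) w =
      W.wordMap f₁ w - W.wordMap f₀ w := by
  induction w with
  | nil =>
    rw [wordDiff_nil, add_zero]
    exact (map_zero _).trans (sub_self _).symm
  | cons x l ih =>
    obtain ⟨p, x⟩ := x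
    have gen_hom (y : E.X (p - 1)) : W.gen (p - 1 + 1) (h.hom (p - 1) (p - 1 + 1) y) =
        W.gen p (h.hom (p - 1) p y) := by rw [sub_add_cancel]
    have hcomm : f₁.f p x = h.hom (p - 1) p (E.d p (p - 1) x) +
        W.cpx.d (p + 1) p (h.hom p (p + 1) x) + f₀.f p x := by
      have := LinearMap.congr_fun (congrArg ModuleCat.Hom.hom (h.comm p)) x
      rwa [dNext_eq _ (show (ComplexShape.down ℤ).Rel p (p - 1) from sub_add_cancel p 1),
        prevD_eq _ (show (ComplexShape.down ℤ).Rel (p + 1) p from rfl)] at this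
    rw [wordDiff_cons, wordDiff_wordHomotopy_cons, wordHomotopy_cons, wordHomotopy_cons,
      wordMap_cons, wordMap_cons, letterDiff]
    dsimp only
    rw [gen_hom, hcomm, eq_sub_of_add_eq' ih]
    have hsign : (p - 1).negOnePow = -p.negOnePow := by
      rw [Int.negOnePow_sub, Int.negOnePow_one, mul_neg_one]
    rw [map_add, map_sign_smul, W.diff_gen_mul rfl, W.diff_gen_mul (sub_add_cancel p 1),
      d_map_apply, Int.negOnePow_succ, hsign]
    simp only [smul_add, smul_smul, Int.units_mul_self, one_smul, Units.neg_smul, map_add, add_mul,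
      mul_sub]
    abel

lemma wordHomotopy_mem_unitalFun {g₁ g₀ : V.cpx ⟶ W.cpx} (h : Homotopy g₁ g₀)
    (hg₁ : g₁.f 0 V.unit = W.unit) (hg₀ : g₀.f 0 V.unit = W.unit)
    (hunit : h.hom 0 1 V.unit = 0) : wordHomotopy h ∈ V.unitalFun W.Env := by
  refine ⟨isMultilinear_wordHomotopy h, fun a b => ?_⟩
  induction a with
  | nil =>
    rw [List.nil_append, List.nil_append, wordHomotopy_cons, hg₀, W.gen_unit, one_mul,
      Int.negOnePow_zero, one_smul, add_eq_right]
    exact (congrArg (W.gen 1 · * _) hunit).trans (by rw [map_zero, zero_mul])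
  | cons y a ih =>
    rw [List.cons_append, List.cons_append, wordHomotopy_cons, wordHomotopy_cons, ih,
      (wordMap_mem_unitalFun hg₁).2]

variable [CharZero K]

/-- The chain homotopy of enveloping algebras induced by a chain homotopy between unit-preserving
chain maps which vanishes on the unit. -/
def pbwHomotopy {g₁ g₀ : V.cpx ⟶ W.cpx} (h : Homotopy g₁ g₀)
    (hg₁ : g₁.f 0 V.unit = W.unit) (hg₀ : g₀.f 0 V.unit = W.unit)
    (hunit : h.hom 0 1 V.unit = 0) : Homotopy (pbwMap g₁ hg₁) (pbwMap g₀ hg₀) :=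
  have hψ := wordHomotopy_mem_unitalFun h hg₁ hg₀ hunit
  homotopyOfLinear (pbwLift hψ)
    (fun n _ => pbwLift_mem (S := fun n => W.grade (n + 1)) hψ (wordHomotopy_mem_grade h))
    fun n z => by
      suffices H : W.diff ∘ₗ pbwLift hψ + pbwLift hψ ∘ₗ V.diff =
          pbwLift (wordMap_mem_unitalFun hg₁) - pbwLift (wordMap_mem_unitalFun hg₀) from
        LinearMap.congr_fun H (V.val n z)
      refine env_hom_ext fun w => ?_
      rw [LinearMap.add_apply, LinearMap.sub_apply, LinearMap.comp_apply, LinearMap.comp_apply,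
        pbwLift_diff_word, pbwLift_word, pbwLift_word, pbwLift_word,
        ← pbw_comp _ (isMultilinear_wordHomotopy h), ← Pi.add_apply, ← Pi.sub_apply, ← map_add,
        ← map_sub]
      exact congrFun (congrArg _ (funext (diff_wordHomotopy_add h))) w

end ULie
end PbwHomotopy

section QuasiIso

variable {K : Type u} [Field K] {V W : ULie K}

namespace ULie

/-- If the unit is a boundary, the left multiplication by a bounding element contracts the
enveloping algebra. -/
def homotopyIdZero {v : V.cpx.X 1} (hv : V.cpx.d 1 0 v = V.unit) : Homotopy (𝟙 V.envCpx) 0 :=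
  homotopyOfLinear (LinearMap.mulLeft K (V.gen 1 v))
    (fun n _ => V.gen_mul_mem_grade (add_comm 1 n) v) fun n z => by
      have hd : V.diff (V.gen 1 v * V.val n z) = V.val n z - V.gen 1 v * V.diff (V.val n z) := by
        rw [V.diff_gen_mul (zero_add 1), hv, V.gen_unit, one_mul, Int.negOnePow_one, Units.neg_smul,
          one_smul, sub_eq_add_neg]
      exact (add_eq_of_eq_sub hd).trans (by simp)

lemma quasiIso_phiShriek_map_of_d_eq_unit (f : V ⟶ W) {v : V.cpx.X 1}
    (hv : V.cpx.d 1 0 v = V.unit) : QuasiIso ((phiShriek K).map f).hom := by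
  have hw : W.cpx.d 1 0 (f.hom.f 1 v) = W.unit := by rw [d_map_apply, hv, f.map_unit]
  let e : HomotopyEquiv V.envCpx W.envCpx :=
    { hom := ((phiShriek K).map f).hom
      inv := 0
      homotopyHomInvId := (Homotopy.ofEq Limits.comp_zero).trans (homotopyIdZero hv).symm
      homotopyInvHomId := (Homotopy.ofEq Limits.zero_comp).trans (homotopyIdZero hw).symm }
  exact e.quasiIso_hom

variable [CharZero K]

lemma quasiIso_phiShriek_map_of_homotopyInverse (f : V ⟶ W) {g : W.cpx ⟶ V.cpx}
    (hg : g.f 0 W.unit = V.unit) (h : Homotopy (f.hom ≫ g) (𝟙 _)) (hh : h.hom 0 1 V.unit = 0)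
    (k : Homotopy (g ≫ f.hom) (𝟙 _)) (hk : k.hom 0 1 W.unit = 0) :
    QuasiIso ((phiShriek K).map f).hom := by
  have pbwMap_id (V : ULie K) : pbwMap (𝟙 V.cpx) rfl = 𝟙 V.envCpx :=
    (pbwMap_hom (𝟙 V)).trans (congrArg DGA.Hom.hom ((phiShriek K).map_id V))
  have hfg : (f.hom ≫ g).f 0 V.unit = V.unit := (congrArg (g.f 0) f.map_unit).trans hg
  have hgf : (g ≫ f.hom).f 0 W.unit = W.unit := (congrArg (f.hom.f 0) hg).trans f.map_unit
  let e : HomotopyEquiv V.envCpx W.envCpx :=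
    { hom := pbwMap f.hom f.map_unit
      inv := pbwMap g hg
      homotopyHomInvId := (Homotopy.ofEq (pbwMap_hom_comp f hg hfg).symm).trans
        ((pbwHomotopy h hfg rfl hh).trans (Homotopy.ofEq (pbwMap_id V)))
      homotopyInvHomId := (Homotopy.ofEq (pbwMap_comp_hom hg f hgf).symm).trans
        ((pbwHomotopy k hgf rfl hk).trans (Homotopy.ofEq (pbwMap_id W))) }
  rw [← pbwMap_hom]
  exact e.quasiIso_hom

lemma quasiIso_phiShriek_map (f : V ⟶ W) (hf : QuasiIso f.hom) :
    QuasiIso ((phiShriek K).map f).hom := by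
  obtain ⟨e, he⟩ := exists_homotopyEquiv_hom_eq f.hom
  by_cases hW : ∃ y, W.cpx.d 1 0 y = W.unit
  · obtain ⟨y, hy⟩ := hW
    obtain ⟨v, hv⟩ := exists_d_eq_unit e (he ▸ f.map_unit) hy
    exact quasiIso_phiShriek_map_of_d_eq_unit f hv
  obtain ⟨ε, hε⟩ := exists_unitHom_comp_eq_id (not_exists.1 hW)
  have hη : V.unitHom ≫ f.hom = W.unitHom := unitHom_comp_eq_iff.2 f.map_unit
  have hinv := exists_homotopyInverse_under e (η := V.unitHom) (ε := ε)
    (by rw [he, reassoc_of% hη, hε])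
  rw [he, hη] at hinv
  obtain ⟨g, hg, ⟨h, hh⟩, k, hk⟩ := hinv
  have eq_zero_of_unitHom {U : ULie K} {φ : U.cpx.X 0 ⟶ U.cpx.X 1}
      (hφ : U.unitHom.f 0 ≫ φ = 0) : φ U.unit = 0 :=
    unitHom_f_comp_eq_iff.1 (hφ.trans (Limits.comp_zero (f := U.unitHom.f 0)).symm)
  exact quasiIso_phiShriek_map_of_homotopyInverse f (unitHom_comp_eq_iff.1 hg)
    h (eq_zero_of_unitHom (hh 0 1)) k (eq_zero_of_unitHom (hk 0 1))

end ULie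
end QuasiIso

end LinearQuantization

end

/-- Linear quantization maps homotopy `W`-constant `Ch(K)`-valued linear field theories to homotopy
`W`-constant quantum field theories. -/
theorem proposition6p8 {K : Type u} [Field K] [CharZero K]
    {C : Type v} [Category.{w} C] (O : LinearQuantization.Orthogonality C)
    (W : MorphismProperty C) (B : LinearQuantization.LFT K O)
    (hB : B.HomotopyConstant W) :
    ((LinearQuantization.Qlin K O).obj B).HomotopyConstant W :=
  fun _ _ f hf => LinearQuantization.ULie.quasiIso_phiShriek_map (B.obj.map f) (hB f hf)
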